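/- **Setting.** Let $d \ge M \ge 2$ be integers. A *curve with $M$ segments in $\mathbb{R}^d$* is given by vertices $c_0,\dots,c_M\in\mathbb{R}^d$ such that the edge vectors $c_i-c_{i-1}$ $(1\le i\le M)$ are linearly independent. It is parametrized with constant speed on $[0,1]$: with $Z=\sum_{k=1}^M\|c_k-c_{k-1}\|$ and $t_i=\frac1Z\sum_{k=1}^i\|c_k-c_{k-1}\|$, the map $C:[0,1]\to\mathbb{R}^d$ is affine on each $[t_{i-1},t_i]$ and $C(t_i)=c_i$. Its moments are the tensors $m_k(C)=\int_0^1 C(t)^{\otimes k}\,dt$. Call $C$ *admissible* if $m_1(C)=0$ and $\|C(t)\|<1$ for all $t\in[0,1]$. For two such curves put $\rho(C,\Gamma)=\int_0^1\|C(t)-\Gamma(t)\|^2\,dt$, and say that $\Gamma$ is *oriented along* $C$ if $\rho(C,\Gamma)\le\int_0^1\|C(t)-\Gamma(1-t)\|^2\,dt$. For $\sigma>0$ let $P_{C,\sigma}$ be the law of $C(\tau)+\sigma\xi$, where $\tau$ is uniform on $[0,1]$ and $\xi\sim\mathcal N(0,I_d)$ is independent of $\tau$. **Theorem 3.5.** There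 is a universal constant $K>0$ (independent of $M$, $d$ and of all curves) such that the following holds for all $d\ge M\ge 2$ and every admissible curve $C$ with $M$ segments in $\mathbb{R}^d$. There is $\Delta_0>0$, which may depend on $C$, such that for every $0<\Delta<\Delta_0$ there exists an admissible curve $\Gamma\ne C$ with $M$ segments in $\mathbb{R}^d$, oriented along $C$, satisfying $$\rho(C,\Gamma)=\Delta,\qquad m_1(\Gamma)=m_1(C),\qquad m_2(\Gamma)=m_2(C),\qquad \|C(t)-\Gamma(t)\|\le \tfrac13\ \text{ for all } t\in[0,1],$$ and indistinguishable from $C$ in the following sense: for every $\sigma\ge1$, every integer $N\ge 0$ with $$N\le K\,\sigma^{6}\,\Delta^{-1}$$ and every measurable test $\psi:(\mathbb{R}^d)^N\to\{C,\Gamma\}$, if the true curve is $C$ or $\Gamma$ with probability $\tfrac12$ each and, given the true curve, $Y$ consists of $N$ independent samples from $P_{C,\sigma}$ or $P_{\Gamma,\sigma}$ respectively, then the probability that $\psi(Y)$ is not the true curve is at least $\tfrac14$, that is, $$\tfrac12\,P_{C,\sigma}^{\otimes N}(\psi=\Gamma)+\tfrac12\,P_{\Gamma,\sigma}^{\otimes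 N}(\psi=C)\ \ge\ \tfrac14 .$$ -/

import Mathlib

open MeasureTheory ProbabilityTheory
open scoped ENNReal

noncomputable section

/-- The vertices `c_0, …, c_M ∈ ℝ^d` of a piecewise linear curve with `M` segments, in generic
position: the edge vectors `c_i - c_{i-1}` are linearly independent. (In particular `M ≤ d`, the
vertices are pairwise distinct, and the curve is open and does not intersect itself.) -/
structure PWLCurve (M d : ℕ) where
  vertex : Fin (M + 1) → EuclideanSpace ℝ (Fin d)
  generic : LinearIndependent ℝ fun i : Fin M => vertex i.succ - vertex i.castSucc

namespace PWLCurve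

variable {M d : ℕ} (C : PWLCurve M d)

/-- The edge vector `c_{i+1} - c_i`. -/
def edge (i : Fin M) : EuclideanSpace ℝ (Fin d) := C.vertex i.succ - C.vertex i.castSucc

/-- The total length `Z` of the curve. -/
def length : ℝ := ∑ i, ‖C.edge i‖

/-- The time `t_i` at which the constant-speed parametrization on `[0, 1]` visits the vertex `c_i`:
the length of the curve up to `c_i`, divided by the total length. -/
def knot (i : Fin (M + 1)) : ℝ :=
  (∑ k : Fin M, if (k : ℕ) < i then ‖C.edge k‖ else 0) / C.length

/-- The constant-speed parametrization `C(t)` of the curve, for `t ∈ [0, 1]`: start at `c_0` and add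
the part of each edge that has been travelled by time `t`. It is affine on each `[t_i, t_{i+1}]`
with the expected formula, see `eval_of_mem_Icc`. -/
def eval (t : ℝ) : EuclideanSpace ℝ (Fin d) :=
  C.vertex 0 + ∑ i : Fin M,
    max 0 (min 1 ((t - C.knot i.castSucc) / (C.knot i.succ - C.knot i.castSucc))) • C.edge i

lemma edge_norm_pos (i : Fin M) : 0 < ‖C.edge i‖ := norm_pos_iff.2 (C.generic.ne_zero i)

lemma length_pos (i : Fin M) : 0 < C.length :=
  Finset.sum_pos (fun k _ => C.edge_norm_pos k) ⟨i, Finset.mem_univ i⟩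

lemma knot_mono : Monotone C.knot := by
  intro i j hij
  unfold knot
  refine div_le_div_of_nonneg_right ?_ (Finset.sum_nonneg fun _ _ => norm_nonneg _)
  refine Finset.sum_le_sum fun k _ => ?_
  have : (i : ℕ) ≤ j := hij
  split_ifs
  · exact le_rfl
  · omega
  · exact norm_nonneg _
  · exact le_rfl

lemma knot_succ_sub (i : Fin M) :
    C.knot i.succ - C.knot i.castSucc = ‖C.edge i‖ / C.length := by
  unfold knot
  rw [← sub_div, ← Finset.sum_sub_distrib]
  congr 1
  rw [Finset.sum_eq_single i]
  · simp
  · intro k _ hk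
    have : (k : ℕ) ≠ i := fun h => hk (Fin.ext h)
    simp only [Fin.val_succ, Fin.val_castSucc]
    split_ifs
    · simp
    · omega
    · omega
    · simp
  · simp

lemma knot_lt (i : Fin M) : C.knot i.castSucc < C.knot i.succ := by
  have := C.knot_succ_sub i
  have h := div_pos (C.edge_norm_pos i) (C.length_pos i)
  linarith

lemma sum_edge (n : ℕ) (hn : n < M + 1) :
    (∑ k : Fin M, if (k : ℕ) < n then C.edge k else 0) = C.vertex ⟨n, hn⟩ - C.vertex 0 := by
  induction n with
  | zero => simp
  | succ n ih =>
    have hnM : n < M := by omega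
    have key : (∑ k : Fin M, if (k : ℕ) < n + 1 then C.edge k else 0)
        = (∑ k : Fin M, if (k : ℕ) < n then C.edge k else 0) + C.edge ⟨n, hnM⟩ := by
      rw [← sub_eq_iff_eq_add', ← Finset.sum_sub_distrib, Finset.sum_eq_single ⟨n, hnM⟩]
      · simp
      · intro k _ hk
        have : (k : ℕ) ≠ n := fun h => hk (Fin.ext h)
        split_ifs
        · simp
        · omega
        · omega
        · simp
      · simp
    rw [key, ih (by omega)]
    simp only [edge, Fin.succ_mk, Fin.castSucc_mk]
    abel

/-- On `[t_i, t_{i+1}]` the parametrization is the linear interpolation of `c_i` and `c_{i+1}`. -/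
lemma eval_of_mem_Icc (i : Fin M) {t : ℝ}
    (ht : t ∈ Set.Icc (C.knot i.castSucc) (C.knot i.succ)) :
    C.eval t =
      ((t - C.knot i.castSucc) / (C.knot i.succ - C.knot i.castSucc)) • C.vertex i.succ
      - ((t - C.knot i.succ) / (C.knot i.succ - C.knot i.castSucc)) • C.vertex i.castSucc := by
  have hi : 0 < C.knot i.succ - C.knot i.castSucc := sub_pos.2 (C.knot_lt i)
  set s := (t - C.knot i.castSucc) / (C.knot i.succ - C.knot i.castSucc) with hs
  have hs0 : 0 ≤ s := div_nonneg (by linarith [ht.1]) hi.le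
  have hs1 : s ≤ 1 := (div_le_one hi).2 (by linarith [ht.2])
  have hs' : (t - C.knot i.succ) / (C.knot i.succ - C.knot i.castSucc) = s - 1 := by
    rw [hs]; field_simp; ring
  have key : ∀ k : Fin M,
      max 0 (min 1 ((t - C.knot k.castSucc) / (C.knot k.succ - C.knot k.castSucc))) • C.edge k
        = (if (k : ℕ) < i then C.edge k else 0) + (if k = i then s • C.edge i else 0) := by
    intro k
    have hk : 0 < C.knot k.succ - C.knot k.castSucc := sub_pos.2 (C.knot_lt k)
    rcases lt_trichotomy k i with h | h | h
    · have h1 : C.knot k.succ ≤ C.knot i.castSucc := C.knot_mono (by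
        rw [Fin.le_def]; simp only [Fin.val_succ, Fin.val_castSucc]; exact h)
      have h2 : 1 ≤ (t - C.knot k.castSucc) / (C.knot k.succ - C.knot k.castSucc) :=
        (one_le_div hk).2 (by linarith [ht.1])
      have h3 : (k : ℕ) < i := h
      simp [min_eq_left h2, h3, h.ne]
    · subst h
      simp [← hs, min_eq_right hs1, max_eq_right hs0]
    · have h1 : C.knot i.succ ≤ C.knot k.castSucc := C.knot_mono (by
        rw [Fin.le_def]; simp only [Fin.val_succ, Fin.val_castSucc]; exact h)
      have h2 : (t - C.knot k.castSucc) / (C.knot k.succ - C.knot k.castSucc) ≤ 0 :=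
        div_nonpos_of_nonpos_of_nonneg (by linarith [ht.2]) hk.le
      have h3 : ¬ (k : ℕ) < i := not_lt.2 (le_of_lt h)
      rw [max_eq_left (le_trans (min_le_right _ _) h2)]
      simp [h3, h.ne']
  have hsum := C.sum_edge i (by omega)
  have hv : (⟨(i : ℕ), by omega⟩ : Fin (M + 1)) = i.castSucc := rfl
  unfold eval
  rw [Finset.sum_congr rfl fun k _ => key k, Finset.sum_add_distrib, hsum, hv,
    Finset.sum_ite_eq' Finset.univ i, hs']
  simp only [Finset.mem_univ, if_true, edge, smul_sub, sub_smul, one_smul]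
  abel

lemma continuous_eval : Continuous C.eval := by
  unfold eval
  refine continuous_const.add (continuous_finsetSum _ fun i _ => ?_)
  fun_prop

/-- The `k`-th moment tensor `m_k(C) = ∫₀¹ C(t)^{⊗k} dt`, given by its entries. -/
def moment (k : ℕ) (j : Fin k → Fin d) : ℝ :=
  ∫ t in (0 : ℝ)..1, ∏ l, C.eval t (j l)

/-- The mean squared distance `∫₀¹ ‖C(t) - Γ(t)‖² dt` between two parametrized curves on `[0, 1]`. -/
def meanSqDist (f g : ℝ → EuclideanSpace ℝ (Fin d)) : ℝ :=
  ∫ t in (0 : ℝ)..1, ‖f t - g t‖ ^ 2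

/-- `ρ(C, Γ)`. It is meant for `Γ` oriented along `C`, see `Aligned`. -/
def rho (C Γ : PWLCurve M d) : ℝ := meanSqDist C.eval Γ.eval

/-- `Γ` is oriented in the direction that minimizes the distance to `C`. -/
def Aligned (C Γ : PWLCurve M d) : Prop :=
  rho C Γ ≤ meanSqDist C.eval fun t => Γ.eval (1 - t)

/-- The standing assumptions on a single curve: it has mean zero (its first moment vanishes) and
stays in the open unit ball. -/
def Admissible : Prop := C.moment 1 = 0 ∧ ∀ t ∈ Set.Icc (0 : ℝ) 1, ‖C.eval t‖ < 1

/-- The law `P_{C,σ}` of `C(τ) + σ ξ`, where `τ` is uniform on `[0, 1]` and `ξ` is an independent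
standard Gaussian vector in `ℝ^d`. -/
def noisyLaw (σ : ℝ) : Measure (EuclideanSpace ℝ (Fin d)) :=
  ((volume.restrict (Set.Icc (0 : ℝ) 1)).prod (stdGaussian (EuclideanSpace ℝ (Fin d)))).map
    fun p => C.eval p.1 + σ • p.2

/-- The law `P_{C,σ}^{⊗N}` of `N` independent samples. -/
def sampleLaw (σ : ℝ) (N : ℕ) : Measure (Fin N → EuclideanSpace ℝ (Fin d)) :=
  Measure.pi fun _ => C.noisyLaw σ

end PWLCurve

/-- The joint law of a hidden label and the data: the label is uniform on `{true, false}`, and given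
the label the data has law `P` (label `true`) or `Q` (label `false`). -/
def uniformPriorLaw {Ω : Type*} [MeasurableSpace Ω] (P Q : Measure Ω) : Measure (Bool × Ω) :=
  (1 / 2 : ℝ≥0∞) • P.map (Prod.mk true) + (1 / 2 : ℝ≥0∞) • Q.map (Prod.mk false)

/-- The probability, under the uniform prior, that the test `ψ` does not return the label. -/
def testError {Ω : Type*} [MeasurableSpace Ω] (P Q : Measure Ω) (ψ : Ω → Bool) : ℝ≥0∞ :=
  uniformPriorLaw P Q {x | ψ x.2 ≠ x.1}

end

section Product

variable {ι : Type*} [Fintype ι] {X : ι → Type*} [∀ i, MeasurableSpace (X i)]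
  (μ : ∀ i, Measure (X i)) [∀ i, IsProbabilityMeasure (μ i)]

lemma lintegral_pi_prod_eq_prod (f : ∀ i, X i → ℝ≥0∞) (hf : ∀ i, Measurable (f i)) :
    ∫⁻ x, ∏ i, f i (x i) ∂Measure.pi μ = ∏ i, ∫⁻ y, f i y ∂μ i := by
  have h := iIndepFun_pi (μ := μ) (X := f) (fun i => (hf i).aemeasurable)
  have h2 := lintegral_prod_eq_prod_lintegral_of_indepFun Finset.univ
    (fun i (x : ∀ i, X i) => f i (x i)) h (fun i => (hf i).comp (measurable_pi_apply i))
  rw [h2]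
  refine Finset.prod_congr rfl fun i _ => ?_
  exact (measurePreserving_eval μ i).lintegral_comp (hf i)

lemma pi_withDensity_eq (f : ∀ i, X i → ℝ≥0∞) (hf : ∀ i, Measurable (f i))
    [∀ i, IsProbabilityMeasure ((μ i).withDensity (f i))] :
    Measure.pi (fun i => (μ i).withDensity (f i))
      = (Measure.pi μ).withDensity fun x => ∏ i, f i (x i) := by
  refine Measure.pi_eq fun s hs => ?_
  rw [withDensity_apply _ (MeasurableSet.univ_pi hs),
    ← lintegral_indicator (MeasurableSet.univ_pi hs)]
  have : (Set.univ.pi s).indicator (fun x : ∀ i, X i => ∏ i, f i (x i))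
      = fun x => ∏ i, (s i).indicator (f i) (x i) := by
    classical
    funext x
    by_cases hx : x ∈ Set.univ.pi s
    · rw [Set.indicator_of_mem hx]
      exact Finset.prod_congr rfl fun i _ => (Set.indicator_of_mem (hx i trivial) _).symm
    · rw [Set.indicator_of_notMem hx]
      simp only [Set.mem_pi, Set.mem_univ, true_implies, not_forall] at hx
      obtain ⟨i, hi⟩ := hx
      exact (Finset.prod_eq_zero (Finset.mem_univ i) (Set.indicator_of_notMem hi _)).symm
  rw [this, lintegral_pi_prod_eq_prod μ _ fun i => (hf i).indicator (hs i)]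
  refine Finset.prod_congr rfl fun i _ => ?_
  rw [lintegral_indicator (hs i), withDensity_apply _ (hs i)]

end Product

section Gaussian

lemma gaussianReal_eq_withDensity (m : ℝ) :
    gaussianReal m 1
      = (gaussianReal 0 1).withDensity fun z => ENNReal.ofReal (Real.exp (m * z - m ^ 2 / 2)) := by
  rw [gaussianReal_of_var_ne_zero _ one_ne_zero, gaussianReal_of_var_ne_zero _ one_ne_zero,
    ← withDensity_mul _ (measurable_gaussianPDF _ _) (by fun_prop)]
  congr 1
  funext z
  simp only [gaussianPDF, Pi.mul_apply]
  rw [← ENNReal.ofReal_mul (gaussianPDFReal_nonneg _ _ _)]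
  congr 1
  simp only [gaussianPDFReal, NNReal.coe_one]
  rw [mul_assoc _ (Real.exp _) (Real.exp _), ← Real.exp_add]
  congr 2
  ring

variable {d : ℕ}

/-- The density of `x + ξ` with respect to the law of the standard Gaussian vector `ξ`. -/
noncomputable def gaussShift (x z : EuclideanSpace ℝ (Fin d)) : ℝ :=
  Real.exp (inner ℝ x z - ‖x‖ ^ 2 / 2)

lemma gaussShift_pos (x z : EuclideanSpace ℝ (Fin d)) : 0 < gaussShift x z := Real.exp_pos _

lemma continuous_gaussShift :
    Continuous fun p : EuclideanSpace ℝ (Fin d) × EuclideanSpace ℝ (Fin d) =>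
      gaussShift p.1 p.2 := by
  unfold gaussShift
  fun_prop

lemma lintegral_stdGaussian_add (x : EuclideanSpace ℝ (Fin d))
    {f : EuclideanSpace ℝ (Fin d) → ℝ≥0∞} (hf : Measurable f) :
    ∫⁻ z, f (x + z) ∂stdGaussian (EuclideanSpace ℝ (Fin d))
      = ∫⁻ z, ENNReal.ofReal (gaussShift x z) * f z ∂stdGaussian (EuclideanSpace ℝ (Fin d)) := by
  have hc : Measurable fun z => gaussShift x z :=
    (continuous_gaussShift.comp (Continuous.prodMk_right x)).measurable
  rw [← map_pi_eq_stdGaussian, lintegral_map (by fun_prop) (by fun_prop),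
    lintegral_map (by fun_prop) (by fun_prop)]
  have h1 : (Measure.pi fun _ : Fin d => gaussianReal 0 1).map (fun z i => x i + z i)
      = Measure.pi fun i => gaussianReal (x i) 1 := by
    have : ∀ i, (gaussianReal 0 1).map (fun z => x i + z) = gaussianReal (x i) 1 := by
      intro i; rw [gaussianReal_map_const_add]; simp
    rw [Measure.pi_map_pi (f := fun i z => x i + z) (fun i => by fun_prop)]
    simp_rw [this]
  have h2 : Measure.pi (fun i => gaussianReal (x i) 1)
      = (Measure.pi fun _ : Fin d => gaussianReal 0 1).withDensity
          fun z => ENNReal.ofReal (gaussShift x (WithLp.toLp 2 z)) := by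
    have : ∀ i, IsProbabilityMeasure ((gaussianReal 0 1).withDensity
        fun z => ENNReal.ofReal (Real.exp (x i * z - x i ^ 2 / 2))) := by
      intro i; rw [← gaussianReal_eq_withDensity]; infer_instance
    have := pi_withDensity_eq (fun _ : Fin d => gaussianReal 0 1)
      (fun i z => ENNReal.ofReal (Real.exp (x i * z - x i ^ 2 / 2))) (fun i => by fun_prop)
    simp_rw [← gaussianReal_eq_withDensity] at this
    rw [this]
    congr 1
    funext z
    rw [← ENNReal.ofReal_prod_of_nonneg (fun _ _ => (Real.exp_pos _).le), ← Real.exp_sum, gaussShift]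
    congr 2
    simp only [PiLp.inner_apply, EuclideanSpace.norm_sq_eq, Finset.sum_sub_distrib,
      Finset.sum_div, Real.norm_eq_abs, sq_abs]
    congr 1
    refine Finset.sum_congr rfl fun i _ => ?_
    simp [mul_comm]
  have h3 : ∀ z : Fin d → ℝ, x + WithLp.toLp 2 z = WithLp.toLp 2 fun i => x i + z i := fun z => rfl
  simp_rw [h3]
  rw [← lintegral_map (f := fun y => f (WithLp.toLp 2 y)) (by fun_prop) (by fun_prop), h1, h2,
    lintegral_withDensity_eq_lintegral_mul _ (by fun_prop) (by fun_prop)]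
  rfl

lemma lintegral_gaussShift (x : EuclideanSpace ℝ (Fin d)) :
    ∫⁻ z, ENNReal.ofReal (gaussShift x z) ∂stdGaussian (EuclideanSpace ℝ (Fin d)) = 1 := by
  have := lintegral_stdGaussian_add x (f := fun _ => 1) measurable_const
  simpa using this.symm

lemma lintegral_gaussShift_mul (x y : EuclideanSpace ℝ (Fin d)) :
    ∫⁻ z, ENNReal.ofReal (gaussShift x z) * ENNReal.ofReal (gaussShift y z)
        ∂stdGaussian (EuclideanSpace ℝ (Fin d)) = ENNReal.ofReal (Real.exp (inner ℝ x y)) := by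
  have hc : ∀ x : EuclideanSpace ℝ (Fin d), Measurable fun z => gaussShift x z := fun x =>
    (continuous_gaussShift.comp (Continuous.prodMk_right x)).measurable
  have h2 : ∀ z, ENNReal.ofReal (gaussShift x z) * ENNReal.ofReal (gaussShift y z)
      = ENNReal.ofReal (Real.exp (inner ℝ x y)) * ENNReal.ofReal (gaussShift (x + y) z) := by
    intro z
    rw [← ENNReal.ofReal_mul (gaussShift_pos _ _).le, ← ENNReal.ofReal_mul (Real.exp_pos _).le]
    unfold gaussShift
    rw [← Real.exp_add, ← Real.exp_add, inner_add_left, norm_add_sq_real]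
    congr 2
    ring
  simp_rw [h2]
  rw [lintegral_const_mul _ (by have := hc (x + y); fun_prop), lintegral_gaussShift, mul_one]

end Gaussian

section SecondDifference

lemma abs_exp_sub_one_sub_id_sub_le {m z w : ℝ} (hm : m ≤ 1) (hz : |z| ≤ m) (hw : |w| ≤ m) :
    |(Real.exp z - 1 - z) - (Real.exp w - 1 - w)| ≤ 2 * m * |z - w| := by
  have h := (convex_Icc (-m) m).norm_image_sub_le_of_norm_hasDerivWithin_le
    (f := fun u => Real.exp u - 1 - u) (f' := fun u => Real.exp u - 1) (C := 2 * m)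
    (fun u _ => (((Real.hasDerivAt_exp u).sub_const 1).sub (hasDerivAt_id u)).hasDerivWithinAt)
    (fun u hu => by
      have hu' : |u| ≤ m := abs_le.2 hu
      have := Real.abs_exp_sub_one_le (hu'.trans hm)
      rw [Real.norm_eq_abs]
      linarith)
    (abs_le.1 hw) (abs_le.1 hz)
  simpa only [Real.norm_eq_abs] using h

variable {E : Type*} [NormedAddCommGroup E] [InnerProductSpace ℝ E]

/-- The mixed second difference of `(u, v) ↦ g ⟪u, v⟫`. -/
def mixedDiff (g : ℝ → ℝ) (a b a' b' : E) : ℝ :=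
  g (inner ℝ b b') - g (inner ℝ b a') - g (inner ℝ a b') + g (inner ℝ a a')

lemma abs_mixedDiff_exp_remainder_le {r : ℝ} (hr : r ≤ 1) {a b a' b' : E} (ha : ‖a‖ ≤ r)
    (hb : ‖b‖ ≤ r) (ha' : ‖a'‖ ≤ r) (hb' : ‖b'‖ ≤ r) :
    |mixedDiff (fun z => Real.exp z - (1 + z + z ^ 2 / 2)) a b a' b'|
      ≤ 3 * r ^ 4 * (‖b - a‖ * ‖b' - a'‖) := by
  have hr0 : 0 ≤ r := (norm_nonneg a).trans ha
  have hr2 : r ^ 2 ≤ 1 := pow_le_one₀ hr0 hr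
  set f : ℝ → ℝ := fun z => Real.exp z - (1 + z + z ^ 2 / 2) with hf
  have hfd : ∀ z, HasDerivAt f (Real.exp z - 1 - z) z := by
    intro z
    have h2 : HasDerivAt (fun z : ℝ => z ^ 2 / 2) z z := by
      have := ((hasDerivAt_id z).pow 2).div_const 2
      simpa using this
    exact ((Real.hasDerivAt_exp z).sub
      (((hasDerivAt_const z (1 : ℝ)).add (hasDerivAt_id z)).add h2)).congr_deriv (by ring)
  have hin : ∀ (v : E) (u : ℝ), HasDerivAt (fun u : ℝ => inner ℝ (a + u • (b - a)) v)
      (inner ℝ (b - a) v) u := by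
    intro v u
    have h1 : HasDerivAt (fun u : ℝ => inner ℝ a v + u * inner ℝ (b - a) v)
        (inner ℝ (b - a) v) u := by
      simpa using ((hasDerivAt_id u).mul_const (inner ℝ (b - a) v)).const_add (inner ℝ a v)
    refine h1.congr_of_eventuallyEq (Filter.Eventually.of_forall fun u => ?_)
    simp only [inner_add_left, real_inner_smul_left]
  have key := (convex_Icc (0 : ℝ) 1).norm_image_sub_le_of_norm_hasDerivWithin_le
    (f := fun u : ℝ => f (inner ℝ (a + u • (b - a)) b') - f (inner ℝ (a + u • (b - a)) a'))
    (C := 3 * r ^ 4 * (‖b - a‖ * ‖b' - a'‖)) (x := 0) (y := 1)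
    (fun u _ => (((hfd _).comp u (hin b' u)).sub ((hfd _).comp u (hin a' u))).hasDerivWithinAt)
    (fun u hu => by
      set v := a + u • (b - a) with hv
      have hvr : ‖v‖ ≤ r := by
        have : v ∈ Metric.closedBall (0 : E) r := by
          have hc := (convex_closedBall (0 : E) r)
          have := hc.add_smul_sub_mem (x := a) (y := b) (by simpa using ha) (by simpa using hb) hu
          exact this
        simpa using this
      have hi : ∀ w : E, ‖w‖ ≤ r → |inner ℝ v w| ≤ r ^ 2 := fun w hw =>
        (abs_real_inner_le_norm v w).trans (by nlinarith [norm_nonneg v, norm_nonneg w])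
      have e1 := abs_exp_sub_one_sub_id_sub_le hr2 (hi b' hb') (hi a' ha')
      have e2 := Real.abs_exp_sub_one_sub_id_le ((hi b' hb').trans hr2)
      have e3 : |inner ℝ v b' - inner ℝ v a'| ≤ r * ‖b' - a'‖ := by
        rw [← inner_sub_right]
        exact (abs_real_inner_le_norm _ _).trans (by gcongr)
      have e4 : |inner ℝ (b - a) a'| ≤ ‖b - a‖ * r :=
        (abs_real_inner_le_norm _ _).trans (by gcongr)
      have e5 : |inner ℝ (b - a) b' - inner ℝ (b - a) a'| ≤ ‖b - a‖ * ‖b' - a'‖ := by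
        rw [← inner_sub_right]
        exact abs_real_inner_le_norm _ _
      have e6 : (inner ℝ v b') ^ 2 ≤ r ^ 4 := by
        rw [← sq_abs]
        calc |inner ℝ v b'| ^ 2 ≤ (r ^ 2) ^ 2 := pow_le_pow_left₀ (abs_nonneg _) (hi b' hb') 2
          _ = r ^ 4 := by ring
      rw [Real.norm_eq_abs]
      set p := Real.exp (inner ℝ v b') - 1 - inner ℝ v b'
      set q := Real.exp (inner ℝ v a') - 1 - inner ℝ v a'
      have : p * inner ℝ (b - a) b' - q * inner ℝ (b - a) a'
          = p * (inner ℝ (b - a) b' - inner ℝ (b - a) a') + (p - q) * inner ℝ (b - a) a' := by ring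
      rw [this]
      calc _ ≤ |p| * |inner ℝ (b - a) b' - inner ℝ (b - a) a'|
              + |p - q| * |inner ℝ (b - a) a'| := by
            rw [← abs_mul, ← abs_mul]; exact abs_add_le _ _
        _ ≤ r ^ 4 * (‖b - a‖ * ‖b' - a'‖)
            + (2 * r ^ 2 * (r * ‖b' - a'‖)) * (‖b - a‖ * r) := by
            refine add_le_add (mul_le_mul (e2.trans e6) e5 (abs_nonneg _) (by positivity))
              (mul_le_mul (e1.trans (by gcongr)) e4 (abs_nonneg _) (by positivity))
        _ = _ := by ring)
    (by simp) (by simp)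
  simp only [one_smul, add_sub_cancel, zero_smul, add_zero, sub_zero, norm_one, mul_one,
    Real.norm_eq_abs] at key
  refine le_of_eq_of_le ?_ key
  unfold mixedDiff
  congr 1
  ring

end SecondDifference

section Integral

variable {α : Type*} [MeasurableSpace α] {μ : Measure α} {f g h k : α → ℝ}

lemma integral_sub_sub_add (hf : Integrable f μ) (hg : Integrable g μ) (hh : Integrable h μ)
    (hk : Integrable k μ) :
    ∫ a, (f a - g a - h a + k a) ∂μ = ∫ a, f a ∂μ - ∫ a, g a ∂μ - ∫ a, h a ∂μ + ∫ a, k a ∂μ := by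
  have h1 : Integrable (fun a => f a - g a) μ := hf.sub hg
  have h2 : Integrable (fun a => f a - g a - h a) μ := h1.sub hh
  rw [integral_add h2 hk, integral_sub h1 hh, integral_sub hf hg]

lemma sq_integral_le_integral_sq [IsProbabilityMeasure μ] (hf : Integrable f μ)
    (hf2 : Integrable (fun a => f a ^ 2) μ) : (∫ a, f a ∂μ) ^ 2 ≤ ∫ a, f a ^ 2 ∂μ := by
  set m := ∫ a, f a ∂μ with hm
  have h0 : 0 ≤ ∫ a, (f a - m) ^ 2 ∂μ := integral_nonneg fun _ => sq_nonneg _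
  have e : ∀ a, (f a - m) ^ 2 = f a ^ 2 - 2 * m * f a - 0 + m ^ 2 := fun a => by ring
  simp_rw [e] at h0
  rw [integral_sub_sub_add hf2 (hf.const_mul _) (integrable_const _) (integrable_const _),
    integral_const_mul, ← hm] at h0
  simp only [integral_const, probReal_univ, one_smul] at h0
  nlinarith

end Integral

section Mixture

variable {d : ℕ} {T : Type*} [MeasurableSpace T] (ν : Measure T)

/-- The density of `x(τ) + ξ` with respect to the law of the standard Gaussian vector `ξ`, when
`τ` has law `ν` and is independent of `ξ`. -/
noncomputable def gaussMix (x : T → EuclideanSpace ℝ (Fin d)) (z : EuclideanSpace ℝ (Fin d)) : ℝ :=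
  ∫ t, gaussShift (x t) z ∂ν

variable {ν} {x y : T → EuclideanSpace ℝ (Fin d)}

lemma gaussMix_nonneg (z : EuclideanSpace ℝ (Fin d)) : 0 ≤ gaussMix ν x z :=
  integral_nonneg fun _ => (gaussShift_pos _ _).le

variable [IsProbabilityMeasure ν]

lemma measurable_gaussShift_comp (hx : Measurable x) :
    Measurable fun p : T × EuclideanSpace ℝ (Fin d) => gaussShift (x p.1) p.2 := by
  unfold gaussShift
  fun_prop

lemma measurable_gaussMix (hx : Measurable x) : Measurable (gaussMix ν x) :=
  ((measurable_gaussShift_comp hx).comp measurable_swap).stronglyMeasurable.integral_prod_right'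
    |>.measurable

lemma gaussShift_le (a z : EuclideanSpace ℝ (Fin d)) : gaussShift a z ≤ Real.exp (‖z‖ ^ 2 / 2) := by
  refine Real.exp_le_exp.2 ?_
  nlinarith [real_inner_le_norm a z, sq_nonneg (‖a‖ - ‖z‖)]

lemma integrable_gaussShift (hx : Measurable x) (z : EuclideanSpace ℝ (Fin d)) :
    Integrable (fun t => gaussShift (x t) z) ν := by
  refine Integrable.of_bound (C := Real.exp (‖z‖ ^ 2 / 2)) ?_ (Filter.Eventually.of_forall fun t => ?_)
  · exact ((measurable_gaussShift_comp hx).comp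
      (measurable_id.prodMk measurable_const)).aestronglyMeasurable
  · rw [Real.norm_eq_abs, abs_of_pos (gaussShift_pos _ _)]
    exact gaussShift_le _ _

lemma ofReal_gaussMix (hx : Measurable x) (z : EuclideanSpace ℝ (Fin d)) :
    ENNReal.ofReal (gaussMix ν x z) = ∫⁻ t, ENNReal.ofReal (gaussShift (x t) z) ∂ν :=
  ofReal_integral_eq_lintegral_ofReal (integrable_gaussShift hx z)
    (Filter.Eventually.of_forall fun _ => (gaussShift_pos _ _).le)

lemma lintegral_gaussMix_mul (hx : Measurable x) {f : EuclideanSpace ℝ (Fin d) → ℝ≥0∞}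
    (hf : Measurable f) :
    ∫⁻ z, ENNReal.ofReal (gaussMix ν x z) * f z ∂stdGaussian (EuclideanSpace ℝ (Fin d))
      = ∫⁻ t, ∫⁻ z, ENNReal.ofReal (gaussShift (x t) z) * f z
          ∂stdGaussian (EuclideanSpace ℝ (Fin d)) ∂ν := by
  have hm := measurable_gaussShift_comp hx
  rw [lintegral_lintegral_swap (by fun_prop)]
  refine lintegral_congr fun z => ?_
  rw [ofReal_gaussMix hx, lintegral_mul_const]
  exact (hm.comp (measurable_id.prodMk measurable_const)).ennreal_ofReal

lemma lintegral_gaussMix_mul_gaussMix (hx : Measurable x) (hy : Measurable y) :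
    ∫⁻ z, ENNReal.ofReal (gaussMix ν x z * gaussMix ν y z)
        ∂stdGaussian (EuclideanSpace ℝ (Fin d))
      = ∫⁻ p, ENNReal.ofReal (Real.exp (inner ℝ (x p.1) (y p.2))) ∂(ν.prod ν) := by
  simp_rw [ENNReal.ofReal_mul (gaussMix_nonneg _)]
  rw [lintegral_gaussMix_mul hx (measurable_gaussMix hy).ennreal_ofReal,
    lintegral_prod _ (by fun_prop)]
  refine lintegral_congr fun t => ?_
  have hc : Measurable fun z => gaussShift (x t) z :=
    (continuous_gaussShift.comp (Continuous.prodMk_right (x t))).measurable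
  simp_rw [mul_comm (ENNReal.ofReal (gaussShift (x t) _))]
  rw [lintegral_gaussMix_mul hy hc.ennreal_ofReal]
  refine lintegral_congr fun s => ?_
  simp_rw [mul_comm (ENNReal.ofReal (gaussShift (y s) _))]
  exact lintegral_gaussShift_mul _ _

lemma integrable_exp_inner (hx : Measurable x) (hy : Measurable y) (hx1 : ∀ᵐ t ∂ν, ‖x t‖ ≤ 1)
    (hy1 : ∀ᵐ t ∂ν, ‖y t‖ ≤ 1) :
    Integrable (fun p : T × T => Real.exp (inner ℝ (x p.1) (y p.2))) (ν.prod ν) := by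
  refine Integrable.of_bound (C := Real.exp 1) (by fun_prop) ?_
  filter_upwards [Measure.quasiMeasurePreserving_fst.ae hx1,
    Measure.quasiMeasurePreserving_snd.ae hy1] with p h1 h2
  rw [Real.norm_eq_abs, abs_of_pos (Real.exp_pos _)]
  refine Real.exp_le_exp.2 ((real_inner_le_norm _ _).trans ?_)
  exact mul_le_one₀ h1 (norm_nonneg _) h2

lemma integrable_gaussMix_mul_gaussMix (hx : Measurable x) (hy : Measurable y)
    (hx1 : ∀ᵐ t ∂ν, ‖x t‖ ≤ 1) (hy1 : ∀ᵐ t ∂ν, ‖y t‖ ≤ 1) :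
    Integrable (fun z => gaussMix ν x z * gaussMix ν y z)
      (stdGaussian (EuclideanSpace ℝ (Fin d))) := by
  refine ⟨((measurable_gaussMix hx).mul (measurable_gaussMix hy)).aestronglyMeasurable, ?_⟩
  rw [hasFiniteIntegral_iff_ofReal (Filter.Eventually.of_forall fun z =>
    mul_nonneg (gaussMix_nonneg z) (gaussMix_nonneg z)), lintegral_gaussMix_mul_gaussMix hx hy]
  exact (integrable_exp_inner hx hy hx1 hy1).lintegral_lt_top

lemma integral_gaussMix_mul_gaussMix (hx : Measurable x) (hy : Measurable y)
    (hx1 : ∀ᵐ t ∂ν, ‖x t‖ ≤ 1) (hy1 : ∀ᵐ t ∂ν, ‖y t‖ ≤ 1) :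
    ∫ z, gaussMix ν x z * gaussMix ν y z ∂stdGaussian (EuclideanSpace ℝ (Fin d))
      = ∫ p, Real.exp (inner ℝ (x p.1) (y p.2)) ∂(ν.prod ν) := by
  rw [integral_eq_lintegral_of_nonneg_ae (Filter.Eventually.of_forall fun z =>
      mul_nonneg (gaussMix_nonneg z) (gaussMix_nonneg z))
      ((measurable_gaussMix hx).mul (measurable_gaussMix hy)).aestronglyMeasurable,
    integral_eq_lintegral_of_nonneg_ae (Filter.Eventually.of_forall fun z => (Real.exp_pos _).le)
      (integrable_exp_inner hx hy hx1 hy1).1, lintegral_gaussMix_mul_gaussMix hx hy]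

lemma lintegral_gaussMix (hx : Measurable x) :
    ∫⁻ z, ENNReal.ofReal (gaussMix ν x z) ∂stdGaussian (EuclideanSpace ℝ (Fin d)) = 1 := by
  have := lintegral_gaussMix_mul (ν := ν) hx (f := fun _ => 1) measurable_const
  simp only [mul_one, lintegral_gaussShift, lintegral_const, measure_univ] at this
  exact this

lemma exp_neg_half_le_gaussMix (hx : Measurable x) (hx1 : ∀ᵐ t ∂ν, ‖x t‖ ≤ 1)
    (h0 : ∀ v, ∫ t, inner ℝ v (x t) ∂ν = 0) (z : EuclideanSpace ℝ (Fin d)) :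
    Real.exp (-(1 / 2)) ≤ gaussMix ν x z := by
  have hi : Integrable (fun t => inner ℝ z (x t)) ν := by
    refine Integrable.of_bound (C := ‖z‖) (by fun_prop) ?_
    filter_upwards [hx1] with t ht
    exact (norm_inner_le_norm _ _).trans (mul_le_of_le_one_right (norm_nonneg _) ht)
  calc Real.exp (-(1 / 2)) = ∫ t, Real.exp (-(1 / 2)) * (inner ℝ z (x t) + 1) ∂ν := by
        rw [integral_const_mul, integral_add hi (integrable_const _), h0]; simp
    _ ≤ gaussMix ν x z := by
        refine integral_mono_ae ((hi.add (integrable_const _)).const_mul _)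
          (integrable_gaussShift hx z) ?_
        filter_upwards [hx1] with t ht
        have h1 : ‖x t‖ ^ 2 ≤ 1 := pow_le_one₀ (norm_nonneg _) ht
        calc Real.exp (-(1 / 2)) * (inner ℝ z (x t) + 1)
            ≤ Real.exp (-(1 / 2)) * Real.exp (inner ℝ z (x t)) := by
              gcongr; exact Real.add_one_le_exp _
          _ = Real.exp (-(1 / 2) + inner ℝ z (x t)) := (Real.exp_add _ _).symm
          _ ≤ gaussShift (x t) z := by
              refine Real.exp_le_exp.2 ?_
              rw [real_inner_comm]
              linarith

/-- If the mixing curves have the same first two moments, the squared distance of the mixture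
densities is of third order. -/
lemma integral_gaussMix_sub_sq_le (hx : Measurable x) (hy : Measurable y) {r : ℝ}
    (hr : r ≤ 1) (hxr : ∀ᵐ t ∂ν, ‖x t‖ ≤ r)
    (hyr : ∀ᵐ t ∂ν, ‖y t‖ ≤ r)
    (h1 : ∀ v, ∫ t, inner ℝ v (y t) ∂ν = ∫ t, inner ℝ v (x t) ∂ν)
    (h2 : ∀ v, ∫ t, inner ℝ v (y t) ^ 2 ∂ν = ∫ t, inner ℝ v (x t) ^ 2 ∂ν) :
    ∫ z, (gaussMix ν y z - gaussMix ν x z) ^ 2 ∂stdGaussian (EuclideanSpace ℝ (Fin d))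
      ≤ 3 * r ^ 4 * ∫ t, ‖y t - x t‖ ^ 2 ∂ν := by
  have hx1 : ∀ᵐ t ∂ν, ‖x t‖ ≤ 1 := hxr.mono fun _ h => h.trans hr
  have hy1 : ∀ᵐ t ∂ν, ‖y t‖ ≤ 1 := hyr.mono fun _ h => h.trans hr
  have hprod : ∀ᵐ p ∂(ν.prod ν), (‖x p.1‖ ≤ r ∧ ‖y p.1‖ ≤ r) ∧ (‖x p.2‖ ≤ r ∧ ‖y p.2‖ ≤ r) := by
    filter_upwards [Measure.quasiMeasurePreserving_fst.ae (hxr.and hyr),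
      Measure.quasiMeasurePreserving_snd.ae (hxr.and hyr)] with p h h'
    exact ⟨h, h'⟩
  set P : ℝ → ℝ := fun z => 1 + z + z ^ 2 / 2 with hP
  have bdd : ∀ {g : ℝ → ℝ}, Continuous g → Integrable
      (fun p : T × T => mixedDiff g (x p.1) (y p.1) (x p.2) (y p.2)) (ν.prod ν) := by
    intro g hg
    obtain ⟨K, hK⟩ := (isCompact_Icc (a := (-1 : ℝ)) (b := 1)).exists_bound_of_continuousOn
      hg.continuousOn
    have hm := hg.measurable
    refine Integrable.of_bound (C := 4 * K) (by unfold mixedDiff; fun_prop) ?_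
    filter_upwards [hprod] with p hp
    have hin : ∀ u v : EuclideanSpace ℝ (Fin d), ‖u‖ ≤ r → ‖v‖ ≤ r → ‖g (inner ℝ u v)‖ ≤ K := by
      intro u v hu hv
      refine hK _ (abs_le.1 ((abs_real_inner_le_norm u v).trans ?_))
      exact mul_le_one₀ (hu.trans hr) (norm_nonneg _) (hv.trans hr)
    have a1 := hin _ _ hp.1.2 hp.2.2
    have a2 := hin _ _ hp.1.2 hp.2.1
    have a3 := hin _ _ hp.1.1 hp.2.2
    have a4 := hin _ _ hp.1.1 hp.2.1
    simp only [Real.norm_eq_abs, abs_le] at a1 a2 a3 a4 ⊢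
    unfold mixedDiff
    constructor <;> linarith [a1.1, a1.2, a2.1, a2.2, a3.1, a3.2, a4.1, a4.2]
  have hinn : ∀ {w : T → EuclideanSpace ℝ (Fin d)}, Measurable w → (∀ᵐ t ∂ν, ‖w t‖ ≤ 1) →
      ∀ v, Integrable (fun t => inner ℝ v (w t)) ν ∧ Integrable (fun t => inner ℝ v (w t) ^ 2) ν := by
    intro w hw hw1 v
    have hb : ∀ᵐ t ∂ν, ‖(inner ℝ v (w t) : ℝ)‖ ≤ ‖v‖ := by
      filter_upwards [hw1] with t ht
      exact (norm_inner_le_norm _ _).trans (mul_le_of_le_one_right (norm_nonneg _) ht)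
    refine ⟨Integrable.of_bound (C := ‖v‖) (by fun_prop) hb,
      Integrable.of_bound (C := ‖v‖ ^ 2) (by fun_prop) ?_⟩
    filter_upwards [hb] with t ht
    rw [norm_pow]
    exact pow_le_pow_left₀ (norm_nonneg _) ht 2
  have hPI : ∀ {w : T → EuclideanSpace ℝ (Fin d)}, Measurable w → (∀ᵐ t ∂ν, ‖w t‖ ≤ 1) →
      ∀ v, Integrable (fun t => P (inner ℝ v (w t))) ν := fun hw hw1 v =>
    ((integrable_const _).add (hinn hw hw1 v).1).add ((hinn hw hw1 v).2.div_const 2)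
  have hPeq : ∀ v, ∫ s, P (inner ℝ v (y s)) ∂ν = ∫ s, P (inner ℝ v (x s)) ∂ν := by
    intro v
    have e : ∀ {w : T → EuclideanSpace ℝ (Fin d)}, Measurable w → (∀ᵐ t ∂ν, ‖w t‖ ≤ 1) →
        ∫ s, P (inner ℝ v (w s)) ∂ν
          = 1 + ∫ s, inner ℝ v (w s) ∂ν + (∫ s, inner ℝ v (w s) ^ 2 ∂ν) / 2 := by
      intro w hw hw1
      have i1 := (hinn hw hw1 v).1
      have i2 := (hinn hw hw1 v).2
      simp only [hP]
      have i3 : Integrable (fun s => 1 + inner ℝ v (w s)) ν := (integrable_const _).add i1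
      rw [integral_add i3 (i2.div_const 2), integral_add (integrable_const _) i1, integral_div]
      simp
    rw [e hy hy1, e hx hx1, h1, h2]
  have hPzero : ∫ p, mixedDiff P (x p.1) (y p.1) (x p.2) (y p.2) ∂(ν.prod ν) = 0 := by
    rw [integral_prod _ (bdd (by fun_prop))]
    refine integral_eq_zero_of_ae (Filter.Eventually.of_forall fun t => ?_)
    simp only [mixedDiff, Pi.zero_apply]
    have i1 := hPI hy hy1 (y t)
    have i2 := hPI hx hx1 (y t)
    have i3 := hPI hy hy1 (x t)
    have i4 := hPI hx hx1 (x t)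
    rw [integral_sub_sub_add i1 i2 i3 i4, hPeq, hPeq]
    ring
  have hexp : ∫ z, (gaussMix ν y z - gaussMix ν x z) ^ 2 ∂stdGaussian (EuclideanSpace ℝ (Fin d))
      = ∫ p, mixedDiff Real.exp (x p.1) (y p.1) (x p.2) (y p.2) ∂(ν.prod ν) := by
    have i1 := integrable_gaussMix_mul_gaussMix hy hy hy1 hy1
    have i2 := integrable_gaussMix_mul_gaussMix hy hx hy1 hx1
    have i3 := integrable_gaussMix_mul_gaussMix hx hy hx1 hy1
    have i4 := integrable_gaussMix_mul_gaussMix hx hx hx1 hx1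
    have j1 := integrable_exp_inner hy hy hy1 hy1
    have j2 := integrable_exp_inner hy hx hy1 hx1
    have j3 := integrable_exp_inner hx hy hx1 hy1
    have j4 := integrable_exp_inner hx hx hx1 hx1
    have e : ∀ z, (gaussMix ν y z - gaussMix ν x z) ^ 2
        = gaussMix ν y z * gaussMix ν y z - gaussMix ν y z * gaussMix ν x z
          - gaussMix ν x z * gaussMix ν y z + gaussMix ν x z * gaussMix ν x z := fun z => by ring
    simp_rw [e, mixedDiff]
    rw [integral_sub_sub_add i1 i2 i3 i4, integral_sub_sub_add j1 j2 j3 j4,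
      integral_gaussMix_mul_gaussMix hy hy hy1 hy1, integral_gaussMix_mul_gaussMix hy hx hy1 hx1,
      integral_gaussMix_mul_gaussMix hx hy hx1 hy1, integral_gaussMix_mul_gaussMix hx hx hx1 hx1]
  have hnI : Integrable (fun t => ‖y t - x t‖) ν := by
    refine Integrable.of_bound (C := 2) (by fun_prop) ?_
    filter_upwards [hx1, hy1] with t a b
    rw [norm_norm]
    linarith [norm_sub_le (y t) (x t)]
  have hnI2 : Integrable (fun t => ‖y t - x t‖ ^ 2) ν := by
    refine Integrable.of_bound (C := 4) (by fun_prop) ?_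
    filter_upwards [hx1, hy1] with t a b
    rw [norm_pow, norm_norm]
    nlinarith [norm_sub_le (y t) (x t), norm_nonneg (y t - x t)]
  have hsplit : ∫ p, mixedDiff Real.exp (x p.1) (y p.1) (x p.2) (y p.2) ∂(ν.prod ν)
      = ∫ p, mixedDiff (fun z => Real.exp z - P z) (x p.1) (y p.1) (x p.2) (y p.2) ∂(ν.prod ν) := by
    rw [← sub_zero (∫ p, mixedDiff Real.exp _ _ _ _ ∂(ν.prod ν)), ← hPzero,
      ← integral_sub (bdd Real.continuous_exp) (bdd (by fun_prop))]
    refine integral_congr_ae (Filter.Eventually.of_forall fun p => ?_)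
    simp only [mixedDiff]
    ring
  rw [hexp, hsplit]
  calc _ ≤ ∫ p : T × T, 3 * r ^ 4 * (‖y p.1 - x p.1‖ * ‖y p.2 - x p.2‖) ∂(ν.prod ν) := by
        refine integral_mono_ae (bdd (by fun_prop)) ((hnI.mul_prod hnI).const_mul _) ?_
        filter_upwards [hprod] with p hp
        exact (le_abs_self _).trans
          (abs_mixedDiff_exp_remainder_le hr hp.1.1 hp.1.2 hp.2.1 hp.2.2)
    _ = 3 * r ^ 4 * (∫ t, ‖y t - x t‖ ∂ν) ^ 2 := by
        rw [integral_const_mul, integral_prod_mul (fun t => ‖y t - x t‖) (fun t => ‖y t - x t‖), sq]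
    _ ≤ _ := by
        gcongr
        exact sq_integral_le_integral_sq hnI hnI2

end Mixture

section Testing

variable {Ω : Type*} [MeasurableSpace Ω]

lemma testError_map {Ω' : Type*} [MeasurableSpace Ω'] (P Q : Measure Ω') {e : Ω' → Ω}
    (he : Measurable e) {ψ : Ω → Bool} (hψ : Measurable ψ) :
    testError (P.map e) (Q.map e) ψ = testError P Q (ψ ∘ e) := by
  have hs : MeasurableSet {x : Bool × Ω | ψ x.2 ≠ x.1} :=
    (measurableSet_eq_fun (hψ.comp measurable_snd) measurable_fst).compl
  have hs' : MeasurableSet {x : Bool × Ω' | (ψ ∘ e) x.2 ≠ x.1} :=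
    (measurableSet_eq_fun ((hψ.comp he).comp measurable_snd) measurable_fst).compl
  simp only [testError, uniformPriorLaw, Measure.add_apply, Measure.smul_apply]
  rw [Measure.map_map measurable_prodMk_left he, Measure.map_map measurable_prodMk_left he,
    Measure.map_apply (measurable_prodMk_left.comp he) hs,
    Measure.map_apply (measurable_prodMk_left.comp he) hs,
    Measure.map_apply measurable_prodMk_left hs', Measure.map_apply measurable_prodMk_left hs']
  rfl

lemma testError_eq (P Q : Measure Ω) {ψ : Ω → Bool} (hψ : Measurable ψ) :
    testError P Q ψ = 1 / 2 * P (ψ ⁻¹' {false}) + 1 / 2 * Q (ψ ⁻¹' {false})ᶜ := by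
  have hs : MeasurableSet {x : Bool × Ω | ψ x.2 ≠ x.1} :=
    (measurableSet_eq_fun (hψ.comp measurable_snd) measurable_fst).compl
  simp only [testError, uniformPriorLaw, Measure.add_apply, Measure.smul_apply, smul_eq_mul]
  rw [Measure.map_apply measurable_prodMk_left hs, Measure.map_apply measurable_prodMk_left hs]
  congr 3
  ext x
  simp

lemma quarter_le_testError (P Q : Measure Ω) [IsProbabilityMeasure P] [IsProbabilityMeasure Q]
    (h : ∀ S, MeasurableSet S → Q.real S - P.real S ≤ 1 / 2) {ψ : Ω → Bool} (hψ : Measurable ψ) :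
    1 / 4 ≤ testError P Q ψ := by
  have hS : MeasurableSet (ψ ⁻¹' {false}) := hψ (measurableSet_singleton _)
  have h1 := h _ hS
  have h2 := probReal_compl_eq_one_sub (μ := Q) hS
  rw [testError_eq P Q hψ]
  rw [← ENNReal.toReal_le_toReal (by simp) (by finiteness), ENNReal.toReal_add (by finiteness)
    (by finiteness), ENNReal.toReal_mul, ENNReal.toReal_mul]
  change _ ≤ _ * P.real _ + _ * Q.real _
  rw [h2]
  norm_num
  linarith

variable {γ : Measure Ω} {p q : Ω → ℝ}

lemma integrable_of_isProbabilityMeasure_withDensity (hp : Measurable p) (hp0 : ∀ z, 0 ≤ p z)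
    [h : IsProbabilityMeasure (γ.withDensity fun z => ENNReal.ofReal (p z))] : Integrable p γ := by
  refine ⟨hp.aestronglyMeasurable, ?_⟩
  rw [hasFiniteIntegral_iff_ofReal (Filter.Eventually.of_forall hp0)]
  have := h.measure_univ
  rw [withDensity_apply _ MeasurableSet.univ, setLIntegral_univ] at this
  simp [this]

lemma integral_of_isProbabilityMeasure_withDensity (hp : Measurable p) (hp0 : ∀ z, 0 ≤ p z)
    [h : IsProbabilityMeasure (γ.withDensity fun z => ENNReal.ofReal (p z))] :
    ∫ z, p z ∂γ = 1 := by
  rw [integral_eq_lintegral_of_nonneg_ae (Filter.Eventually.of_forall hp0) hp.aestronglyMeasurable]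
  have := h.measure_univ
  rw [withDensity_apply _ MeasurableSet.univ, setLIntegral_univ] at this
  simp [this]

lemma measureReal_withDensity (hp : Measurable p) (hp0 : ∀ z, 0 ≤ p z) {S : Set Ω}
    (hS : MeasurableSet S) :
    (γ.withDensity fun z => ENNReal.ofReal (p z)).real S = ∫ z in S, p z ∂γ := by
  rw [measureReal_def, withDensity_apply _ hS, integral_eq_lintegral_of_nonneg_ae
    (Filter.Eventually.of_forall hp0) hp.aestronglyMeasurable]

variable [IsProbabilityMeasure γ]

/-- A bound on the total variation distance by the `χ²` divergence. -/
lemma setIntegral_sub_le_of_integral_sq_div_le (hp : Integrable p γ) (hp0 : ∀ z, 0 < p z)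
    (hq : Integrable q γ) (hp1 : ∫ z, p z ∂γ = 1) (hq1 : ∫ z, q z ∂γ = 1)
    (hi : Integrable (fun z => q z ^ 2 / p z) γ) (hle : ∫ z, q z ^ 2 / p z ∂γ ≤ 5 / 4)
    (S : Set Ω) :
    ∫ z in S, q z ∂γ - ∫ z in S, p z ∂γ ≤ 1 / 2 := by
  have e : ∀ z, q z ^ 2 / p z - 2 * q z - 0 + 5 / 4 * p z = (q z - p z) ^ 2 / p z + p z / 4 := by
    intro z
    have := (hp0 z).ne'
    field_simp
    ring
  have hI : Integrable (fun z => q z ^ 2 / p z - 2 * q z - 0 + 5 / 4 * p z) γ :=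
    ((hi.sub (hq.const_mul 2)).sub (integrable_const 0)).add (hp.const_mul (5 / 4))
  rw [← integral_sub hq.integrableOn hp.integrableOn]
  calc ∫ z in S, (q z - p z) ∂γ
      ≤ ∫ z in S, (q z ^ 2 / p z - 2 * q z - 0 + 5 / 4 * p z) ∂γ := by
        refine setIntegral_mono (hq.sub hp).integrableOn hI.integrableOn fun z => ?_
        rw [e]
        have h0 := hp0 z
        have h1 : (q z - p z) ^ 2 / p z + p z / 4 - (q z - p z)
            = ((q z - p z) - p z / 2) ^ 2 / p z := by
          field_simp
          ring
        have h2 : 0 ≤ ((q z - p z) - p z / 2) ^ 2 / p z := by positivity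
        show q z - p z ≤ _
        linarith
    _ ≤ ∫ z, (q z ^ 2 / p z - 2 * q z - 0 + 5 / 4 * p z) ∂γ := by
        refine setIntegral_le_integral hI (Filter.Eventually.of_forall fun z => ?_)
        have h0 := hp0 z
        simp only [e, Pi.zero_apply]
        positivity
    _ ≤ 1 / 2 := by
        rw [integral_sub_sub_add hi (hq.const_mul 2) (integrable_const 0) (hp.const_mul (5 / 4)),
          integral_const_mul, integral_const_mul, hp1, hq1]
        simp only [integral_zero]
        linarith

lemma quarter_le_testError_pi (hpm : Measurable p) (hqm : Measurable q) (hq0 : ∀ z, 0 ≤ q z)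
    {c ε : ℝ} (hc : 0 < c) (hpc : ∀ z, c ≤ p z)
    [IsProbabilityMeasure (γ.withDensity fun z => ENNReal.ofReal (p z))]
    [IsProbabilityMeasure (γ.withDensity fun z => ENNReal.ofReal (q z))]
    (hi : Integrable (fun z => (q z - p z) ^ 2) γ) (hle : ∫ z, (q z - p z) ^ 2 ∂γ ≤ c * ε)
    (N : ℕ) (hN : N * ε ≤ 1 / 5) {ψ : (Fin N → Ω) → Bool} (hψ : Measurable ψ) :
    1 / 4 ≤ testError (Measure.pi fun _ => γ.withDensity fun z => ENNReal.ofReal (p z))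
      (Measure.pi fun _ => γ.withDensity fun z => ENNReal.ofReal (q z)) ψ := by
  have hp0 : ∀ z, 0 < p z := fun z => hc.trans_le (hpc z)
  have hpI := integrable_of_isProbabilityMeasure_withDensity (γ := γ) hpm fun z => (hp0 z).le
  have hqI := integrable_of_isProbabilityMeasure_withDensity (γ := γ) hqm hq0
  have hp1 := integral_of_isProbabilityMeasure_withDensity (γ := γ) hpm fun z => (hp0 z).le
  have hq1 := integral_of_isProbabilityMeasure_withDensity (γ := γ) hqm hq0
  have e : ∀ z, q z ^ 2 / p z = (q z - p z) ^ 2 / p z - (-2) * q z - p z + 0 := by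
    intro z
    have := (hp0 z).ne'
    field_simp
    ring
  have hdiv : ∀ z, (q z - p z) ^ 2 / p z ≤ c⁻¹ * (q z - p z) ^ 2 := by
    intro z
    rw [div_eq_inv_mul]
    gcongr
    exact hpc z
  have hdI : Integrable (fun z => (q z - p z) ^ 2 / p z) γ := by
    refine (hi.const_mul c⁻¹).mono' ((((hqm.sub hpm).pow_const 2).div hpm).aestronglyMeasurable)
      (Filter.Eventually.of_forall fun z => ?_)
    rw [Real.norm_eq_abs, abs_of_nonneg (by have := hp0 z; positivity)]
    exact hdiv z
  have hsI : Integrable (fun z => q z ^ 2 / p z) γ := by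
    simp_rw [e]
    exact ((hdI.sub (hqI.const_mul (-2))).sub hpI).add (integrable_const 0)
  have hs : ∫ z, q z ^ 2 / p z ∂γ ≤ 1 + ε := by
    simp_rw [e]
    rw [integral_sub_sub_add hdI (hqI.const_mul (-2)) hpI (integrable_const 0), integral_const_mul,
      hp1, hq1]
    have : ∫ z, (q z - p z) ^ 2 / p z ∂γ ≤ ε := by
      calc _ ≤ ∫ z, c⁻¹ * (q z - p z) ^ 2 ∂γ := integral_mono hdI (hi.const_mul _) hdiv
        _ = c⁻¹ * ∫ z, (q z - p z) ^ 2 ∂γ := integral_const_mul _ _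
        _ ≤ c⁻¹ * (c * ε) := by gcongr
        _ = ε := by field_simp
    simp only [integral_zero]
    linarith
  have hs0 : 0 ≤ ∫ z, q z ^ 2 / p z ∂γ :=
    integral_nonneg fun z => div_nonneg (sq_nonneg _) (hp0 z).le
  have hpow : (∫ z, q z ^ 2 / p z ∂γ) ^ N ≤ 5 / 4 := by
    calc (∫ z, q z ^ 2 / p z ∂γ) ^ N ≤ (Real.exp ε) ^ N := by
          refine pow_le_pow_left₀ hs0 (hs.trans ?_) N
          linarith [Real.add_one_le_exp ε]
      _ = Real.exp (N * ε) := (Real.exp_nat_mul _ _).symm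
      _ ≤ Real.exp (1 / 5) := Real.exp_le_exp.2 hN
      _ ≤ 1 / (1 - 1 / 5) := by
          have := Real.one_sub_le_exp_neg (1 / 5)
          rw [Real.exp_neg] at this
          rw [le_div_iff₀ (by norm_num), ← le_inv_mul_iff₀ (Real.exp_pos _), mul_one]
          exact this
      _ = 5 / 4 := by norm_num
  have hprod : ∀ {f : Ω → ℝ}, Measurable f → (∀ z, 0 ≤ f z) →
      IsProbabilityMeasure (γ.withDensity fun z => ENNReal.ofReal (f z)) →
      (Measure.pi fun _ : Fin N => γ.withDensity fun z => ENNReal.ofReal (f z))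
        = (Measure.pi fun _ : Fin N => γ).withDensity
            fun x => ENNReal.ofReal (∏ i, f (x i)) := by
    intro f hf hf0 _
    rw [pi_withDensity_eq (fun _ : Fin N => γ) (fun _ z => ENNReal.ofReal (f z))
      (fun _ => hf.ennreal_ofReal)]
    congr 1
    funext x
    rw [ENNReal.ofReal_prod_of_nonneg fun i _ => hf0 _]
  refine quarter_le_testError _ _ (fun S hS => ?_) hψ
  rw [hprod hpm (fun z => (hp0 z).le) inferInstance, hprod hqm hq0 inferInstance,
    measureReal_withDensity (by fun_prop) (fun x => Finset.prod_nonneg fun i _ => hq0 _) hS,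
    measureReal_withDensity (by fun_prop) (fun x => Finset.prod_nonneg fun i _ => (hp0 _).le) hS]
  refine setIntegral_sub_le_of_integral_sq_div_le (Integrable.fintype_prod fun _ => hpI)
    (fun x => Finset.prod_pos fun i _ => hp0 _) (Integrable.fintype_prod fun _ => hqI) ?_ ?_ ?_ ?_ S
  · rw [integral_fintype_prod_eq_pow, hp1, one_pow]
  · rw [integral_fintype_prod_eq_pow, hq1, one_pow]
  · simp_rw [← Finset.prod_pow, ← Finset.prod_div_distrib]
    exact Integrable.fintype_prod (f := fun _ z => q z ^ 2 / p z) fun _ => hsI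
  · simp_rw [← Finset.prod_pow, ← Finset.prod_div_distrib]
    rw [integral_fintype_prod_eq_pow (fun z => q z ^ 2 / p z)]
    simpa using hpow

end Testing

namespace PWLCurve

variable {M d : ℕ}

/-- The uniform distribution on `[0, 1]`. -/
noncomputable abbrev unifIcc : Measure ℝ := volume.restrict (Set.Icc (0 : ℝ) 1)

instance isProbabilityMeasure_unifIcc : IsProbabilityMeasure unifIcc := ⟨by simp⟩

lemma noisyLaw_eq_map (C : PWLCurve M d) {σ : ℝ} (hσ : 0 < σ) :
    C.noisyLaw σ = ((stdGaussian (EuclideanSpace ℝ (Fin d))).withDensity fun z =>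
      ENNReal.ofReal (gaussMix unifIcc (fun t => σ⁻¹ • C.eval t) z)).map fun z => σ • z := by
  have hC := C.continuous_eval.measurable
  have hx : Measurable fun t => σ⁻¹ • C.eval t := by fun_prop
  ext s hs
  have hs' : MeasurableSet ((fun z : EuclideanSpace ℝ (Fin d) => σ • z) ⁻¹' s) :=
    hs.preimage (by fun_prop)
  rw [noisyLaw, ← lintegral_indicator_one hs, lintegral_map (measurable_one.indicator hs)
    (by fun_prop), lintegral_prod _ (by
      exact ((measurable_one.indicator hs).comp (by fun_prop)).aemeasurable),
    Measure.map_apply (by fun_prop) hs, withDensity_apply _ hs', ← lintegral_indicator hs']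
  have h1 : ∀ z, ((fun z : EuclideanSpace ℝ (Fin d) => σ • z) ⁻¹' s).indicator
      (fun z => ENNReal.ofReal (gaussMix unifIcc (fun t => σ⁻¹ • C.eval t) z)) z
      = ENNReal.ofReal (gaussMix unifIcc (fun t => σ⁻¹ • C.eval t) z)
        * s.indicator 1 (σ • z) := by
    intro z
    by_cases hz : σ • z ∈ s
    · simp [hz]
    · simp [hz]
  simp_rw [h1]
  have hm : Measurable fun z : EuclideanSpace ℝ (Fin d) =>
      s.indicator (1 : EuclideanSpace ℝ (Fin d) → ℝ≥0∞) (σ • z) :=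
    (measurable_one.indicator hs).comp (by fun_prop)
  rw [lintegral_gaussMix_mul hx hm]
  refine lintegral_congr fun t => ?_
  rw [← lintegral_stdGaussian_add _ hm]
  refine lintegral_congr fun z => ?_
  rw [smul_add, smul_inv_smul₀ hσ.ne']

lemma integral_unifIcc (f : ℝ → ℝ) : ∫ t, f t ∂unifIcc = ∫ t in (0 : ℝ)..1, f t := by
  rw [intervalIntegral.integral_of_le zero_le_one, integral_Icc_eq_integral_Ioc]

lemma integral_inner_eval (C : PWLCurve M d) (v : EuclideanSpace ℝ (Fin d)) :
    ∫ t in (0 : ℝ)..1, inner ℝ v (C.eval t) = ∑ i, v i * C.moment 1 fun _ => i := by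
  have hC := C.continuous_eval
  simp only [moment, Finset.univ_unique, Finset.prod_singleton]
  simp_rw [← intervalIntegral.integral_const_mul]
  rw [← intervalIntegral.integral_finsetSum fun i _ =>
    Continuous.intervalIntegrable (by fun_prop) _ _]
  refine intervalIntegral.integral_congr fun t _ => ?_
  simp [PiLp.inner_apply, mul_comm]

lemma integral_inner_eval_sq (C : PWLCurve M d) (v : EuclideanSpace ℝ (Fin d)) :
    ∫ t in (0 : ℝ)..1, inner ℝ v (C.eval t) ^ 2
      = ∑ i, ∑ j, v i * v j * C.moment 2 ![i, j] := by
  have hC := C.continuous_eval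
  simp only [moment, Fin.prod_univ_two, Matrix.cons_val_zero, Matrix.cons_val_one]
  simp_rw [← intervalIntegral.integral_const_mul]
  have h : ∀ i, ∑ j, ∫ t in (0 : ℝ)..1, v i * v j * (C.eval t i * C.eval t j)
      = ∫ t in (0 : ℝ)..1, ∑ j, v i * v j * (C.eval t i * C.eval t j) := fun i =>
    (intervalIntegral.integral_finsetSum fun j _ =>
      Continuous.intervalIntegrable (by fun_prop) _ _).symm
  simp_rw [h]
  rw [← intervalIntegral.integral_finsetSum fun i _ =>
    Continuous.intervalIntegrable (by fun_prop) _ _]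
  refine intervalIntegral.integral_congr fun t _ => ?_
  simp only [PiLp.inner_apply, sq, Finset.sum_mul_sum]
  refine Finset.sum_congr rfl fun i _ => Finset.sum_congr rfl fun j _ => ?_
  simp
  ring

/-- Curves with the same first two moments cannot be told apart from few noisy samples. -/
theorem quarter_le_testError_sampleLaw {C Γ : PWLCurve M d} (hC : C.Admissible)
    (hΓ : Γ.Admissible) (hm : C.moment 2 = Γ.moment 2) {σ : ℝ} {N : ℕ} (hσ : 1 ≤ σ)
    (hN : N * (σ⁻¹ ^ 6 * rho C Γ) ≤ 1 / 30) {ψ : (Fin N → EuclideanSpace ℝ (Fin d)) → Bool}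
    (hψ : Measurable ψ) : 1 / 4 ≤ testError (C.sampleLaw σ N) (Γ.sampleLaw σ N) ψ := by
  have hσ0 : 0 < σ := zero_lt_one.trans_le hσ
  have hr1 : σ⁻¹ ≤ 1 := inv_le_one_of_one_le₀ hσ
  have hr0 : 0 ≤ σ⁻¹ := by positivity
  have hmeas : ∀ D : PWLCurve M d, Measurable fun t => σ⁻¹ • D.eval t := fun D => by
    have := D.continuous_eval.measurable
    fun_prop
  have hbd : ∀ {D : PWLCurve M d}, D.Admissible → ∀ᵐ t ∂unifIcc, ‖σ⁻¹ • D.eval t‖ ≤ σ⁻¹ := by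
    intro D hD
    refine (ae_restrict_iff' measurableSet_Icc).2 (Filter.Eventually.of_forall fun t ht => ?_)
    rw [norm_smul, norm_inv, Real.norm_of_nonneg hσ0.le]
    exact mul_le_of_le_one_right hr0 (hD.2 t ht).le
  have h1 : ∀ {D : PWLCurve M d}, D.Admissible → ∀ v,
      ∫ t, inner ℝ v (σ⁻¹ • D.eval t) ∂unifIcc = 0 := by
    intro D hD v
    simp_rw [real_inner_smul_right]
    rw [integral_const_mul, integral_unifIcc, integral_inner_eval, hD.1]
    simp
  have h2 : ∀ v, ∫ t, inner ℝ v (σ⁻¹ • Γ.eval t) ^ 2 ∂unifIcc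
      = ∫ t, inner ℝ v (σ⁻¹ • C.eval t) ^ 2 ∂unifIcc := by
    intro v
    simp_rw [real_inner_smul_right, mul_pow]
    rw [integral_const_mul, integral_const_mul, integral_unifIcc, integral_unifIcc,
      integral_inner_eval_sq, integral_inner_eval_sq, hm]
  have hsq := integral_gaussMix_sub_sq_le (hmeas C) (hmeas Γ) hr1 (hbd hC) (hbd hΓ)
    (fun v => by rw [h1 hC, h1 hΓ]) h2
  have hrho : ∫ t, ‖σ⁻¹ • Γ.eval t - σ⁻¹ • C.eval t‖ ^ 2 ∂unifIcc = σ⁻¹ ^ 2 * rho C Γ := by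
    simp_rw [← smul_sub, norm_smul, mul_pow, norm_inv, Real.norm_of_nonneg hσ0.le]
    rw [integral_const_mul, integral_unifIcc, rho, meanSqDist]
    simp_rw [norm_sub_rev (C.eval _)]
  have hone : ∀ {D : PWLCurve M d}, D.Admissible → ∀ᵐ t ∂unifIcc, ‖σ⁻¹ • D.eval t‖ ≤ 1 :=
    fun hD => (hbd hD).mono fun _ h => h.trans hr1
  have hprob : ∀ D : PWLCurve M d, IsProbabilityMeasure
      ((stdGaussian (EuclideanSpace ℝ (Fin d))).withDensity fun z =>
        ENNReal.ofReal (gaussMix unifIcc (fun t => σ⁻¹ • D.eval t) z)) := fun D => ⟨by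
    rw [withDensity_apply _ MeasurableSet.univ, setLIntegral_univ, lintegral_gaussMix (hmeas D)]⟩
  have hi := hprob C
  have hj := hprob Γ
  have hmap : ∀ D : PWLCurve M d, D.sampleLaw σ N
      = (Measure.pi fun _ : Fin N => (stdGaussian (EuclideanSpace ℝ (Fin d))).withDensity fun z =>
        ENNReal.ofReal (gaussMix unifIcc (fun t => σ⁻¹ • D.eval t) z)).map
          fun z i => σ • z i := by
    intro D
    have hk := hprob D
    rw [sampleLaw, noisyLaw_eq_map D hσ0,
      Measure.pi_map_pi (f := fun (_ : Fin N) (z : EuclideanSpace ℝ (Fin d)) => σ • z)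
        (fun _ => by fun_prop)]
  rw [hmap, hmap, testError_map _ _ (by fun_prop) hψ]
  have hlow := exp_neg_half_le_gaussMix (hmeas C) (hone hC) (h1 hC)
  have hexp : (1 / 2 : ℝ) ≤ Real.exp (-(1 / 2)) := by
    linarith [Real.add_one_le_exp (-(1 / 2) : ℝ)]
  refine quarter_le_testError_pi (c := 1 / 2) (ε := 6 * (σ⁻¹ ^ 6 * rho C Γ))
    (measurable_gaussMix (hmeas C)) (measurable_gaussMix (hmeas Γ)) (fun z => gaussMix_nonneg z)
    (by norm_num) (fun z => hexp.trans (hlow z)) ?_ ?_ N (by linarith)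
    (hψ.comp (by fun_prop))
  · have i1 := integrable_gaussMix_mul_gaussMix (hmeas Γ) (hmeas Γ) (hone hΓ) (hone hΓ)
    have i2 := integrable_gaussMix_mul_gaussMix (hmeas Γ) (hmeas C) (hone hΓ) (hone hC)
    have i3 := integrable_gaussMix_mul_gaussMix (hmeas C) (hmeas C) (hone hC) (hone hC)
    refine ((i1.sub (i2.const_mul 2)).add i3).congr (Filter.Eventually.of_forall fun z => ?_)
    simp only [Pi.add_apply, Pi.sub_apply]
    ring
  · rw [hrho] at hsq
    refine hsq.trans (le_of_eq ?_)
    ring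

end PWLCurve

section Polygon

variable {E : Type*} [NormedAddCommGroup E] {M n : ℕ}

/-- The length of the `k`-th edge of a polygonal line relative to the total length. -/
noncomputable def relLen (c : Fin (M + 1) → E) (k : Fin M) : ℝ :=
  ‖c k.succ - c k.castSucc‖ / ∑ i : Fin M, ‖c i.succ - c i.castSucc‖

lemma relLen_nonneg (c : Fin (M + 1) → E) (k : Fin M) : 0 ≤ relLen c k :=
  div_nonneg (norm_nonneg _) (Finset.sum_nonneg fun _ _ => norm_nonneg _)

lemma relLen_pos {c : Fin (M + 1) → E} (hc : ∀ k : Fin M, c k.succ - c k.castSucc ≠ 0) (k : Fin M) :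
    0 < relLen c k :=
  div_pos (norm_pos_iff.2 (hc k))
    (Finset.sum_pos (fun i _ => norm_pos_iff.2 (hc i)) ⟨k, Finset.mem_univ k⟩)

variable [InnerProductSpace ℝ E]

/-- The barycenter of a polygonal line. -/
noncomputable def barycenter (c : Fin (M + 1) → E) : E :=
  ∑ k, relLen c k • (1 / 2 : ℝ) • (c k.castSucc + c k.succ)

/-- Simpson's rule on the segment from `a` to `b`. -/
noncomputable def simpson (g : E → ℝ) (a b : E) : ℝ :=
  (g a + 4 * g ((1 / 2 : ℝ) • (a + b)) + g b) / 6

/-- The covariance matrix of the uniform distribution on a polygonal line. -/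
noncomputable def polyCov (c : Fin (M + 1) → EuclideanSpace ℝ (Fin n)) (i j : Fin n) : ℝ :=
  ∑ k, relLen c k * simpson (fun p => p i * p j) (c k.castSucc) (c k.succ)
    - barycenter c i * barycenter c j

/-- The variance of the uniform distribution on a polygonal line in the direction `u`. -/
noncomputable def polyVar (u : E) (c : Fin (M + 1) → E) : ℝ :=
  ∑ k, relLen c k * simpson (fun p => inner ℝ u p ^ 2) (c k.castSucc) (c k.succ)
    - (inner ℝ u (barycenter c)) ^ 2

lemma simpson_nonneg {g : E → ℝ} (hg : ∀ p, 0 ≤ g p) (a b : E) : 0 ≤ simpson g a b := by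
  have h1 := hg a
  have h2 := hg b
  have h3 := hg ((1 / 2 : ℝ) • (a + b))
  unfold simpson
  positivity

lemma polyVar_eq (u : E) (c : Fin (M + 1) → E) :
    polyVar u c = ∑ k, relLen c k * simpson (fun p => inner ℝ u p ^ 2) (c k.castSucc) (c k.succ)
      - (∑ k, relLen c k * inner ℝ u ((1 / 2 : ℝ) • (c k.castSucc + c k.succ))) ^ 2 := by
  rw [polyVar, barycenter, inner_sum]
  simp_rw [real_inner_smul_right]

/-- The derivative of the relative edge lengths under a linear deformation. -/
lemma hasDerivAt_relLen_add_smul {c : Fin (M + 1) → E}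
    (hc : ∀ k : Fin M, c k.succ - c k.castSucc ≠ 0) (P : E →L[ℝ] E) (a : Fin M → ℝ)
    (ha : ∀ k : Fin M, inner ℝ (c k.succ - c k.castSucc) (P (c k.succ - c k.castSucc))
      = a k * ‖c k.succ - c k.castSucc‖ ^ 2) (k : Fin M) :
    HasDerivAt (fun s : ℝ => relLen (fun i => c i + s • P (c i)) k)
      (relLen c k * (a k - ∑ i, relLen c i * a i)) 0 := by
  have hL : ∀ k : Fin M, HasDerivAt
      (fun s : ℝ => ‖(c k.succ + s • P (c k.succ)) - (c k.castSucc + s • P (c k.castSucc))‖)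
      (‖c k.succ - c k.castSucc‖ * a k) 0 := by
    intro k
    set e := c k.succ - c k.castSucc with he
    have h1 : ∀ s : ℝ, (c k.succ + s • P (c k.succ)) - (c k.castSucc + s • P (c k.castSucc))
        = e + s • P e := by
      intro s; rw [he, map_sub]; module
    simp_rw [h1]
    have h2 : HasDerivAt (fun s : ℝ => e + s • P e) (P e) 0 := by
      simpa using ((hasDerivAt_id (0 : ℝ)).smul_const (P e)).const_add e
    have h3 := h2.norm_sq.sqrt (by simpa using hc k)
    have hn : ‖e‖ ≠ 0 := norm_ne_zero_iff.2 (hc k)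
    have h5 := h3.congr_deriv (g' := ‖e‖ * a k) (by
      simp only [zero_smul, add_zero, Real.sqrt_sq (norm_nonneg e)]
      rw [he, ha k, ← he]
      field_simp)
    simpa only [Real.sqrt_sq (norm_nonneg _)] using h5
  have hZ : (∑ i : Fin M, ‖c i.succ - c i.castSucc‖) ≠ 0 :=
    (Finset.sum_pos (fun i _ => norm_pos_iff.2 (hc i)) ⟨k, Finset.mem_univ k⟩).ne'
  have hS := HasDerivAt.fun_sum (u := Finset.univ) fun i _ => hL i
  have := (hL k).div hS (by simpa using hZ)
  refine this.congr_deriv ?_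
  simp only [zero_smul, add_zero, relLen]
  simp_rw [div_mul_eq_mul_div]
  rw [← Finset.sum_div]
  field_simp

/-- If a combination of the variances in the directions of an orthonormal basis is stationary under
all linear deformations of a polygonal line, then no coefficient is positive. -/
lemma coeff_nonpos_of_stationary {c : Fin (M + 1) → EuclideanSpace ℝ (Fin n)}
    (hM : 0 < M) (hc : ∀ k : Fin M, c k.succ - c k.castSucc ≠ 0)
    (hspan : ∀ v, (∀ k : Fin M, inner ℝ v (c k.succ - c k.castSucc) = 0) → v = 0)
    (hbar : barycenter c = 0) (f : OrthonormalBasis (Fin n) ℝ (EuclideanSpace ℝ (Fin n)))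
    (l : Fin n → ℝ)
    (hst : ∀ Y : EuclideanSpace ℝ (Fin n) →L[ℝ] EuclideanSpace ℝ (Fin n),
      HasDerivAt (fun s : ℝ => ∑ j, l j * polyVar (f j) (fun i => c i + s • Y (c i))) 0 0)
    (j : Fin n) : l j ≤ 0 := by
  classical
  -- the variance along `f j` under a deformation which is diagonal in the basis `f`
  set A : Fin n → Fin M → ℝ :=
    fun j k => simpson (fun p => inner ℝ (f j) p ^ 2) (c k.castSucc) (c k.succ) with hA
  set B : Fin n → Fin M → ℝ :=
    fun j k => inner ℝ (f j) ((1 / 2 : ℝ) • (c k.castSucc + c k.succ)) with hB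
  have hA0 : ∀ j k, 0 ≤ A j k := fun j k => simpson_nonneg (fun p => sq_nonneg _) _ _
  have hB0 : ∀ j, ∑ k, relLen c k * B j k = 0 := by
    intro j
    simp only [hB]
    simp_rw [← real_inner_smul_right]
    rw [← inner_sum]
    change inner ℝ (f j) (barycenter c) = 0
    rw [hbar, inner_zero_right]
  have hder : ∀ (δ : Fin n → ℝ) (P : EuclideanSpace ℝ (Fin n) →L[ℝ] EuclideanSpace ℝ (Fin n))
      (a : Fin M → ℝ), (∀ j v, inner ℝ (f j) (P v) = δ j * inner ℝ (f j) v) →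
      (∀ k : Fin M, inner ℝ (c k.succ - c k.castSucc) (P (c k.succ - c k.castSucc))
        = a k * ‖c k.succ - c k.castSucc‖ ^ 2) →
      ∑ j, l j * (2 * δ j * ∑ k, relLen c k * A j k
        + ∑ k, relLen c k * (a k - ∑ i, relLen c i * a i) * A j k) = 0 := by
    intro δ P a hP ha
    have hw := fun k => hasDerivAt_relLen_add_smul hc P a ha k
    have hval : ∀ (s : ℝ) j, polyVar (f j) (fun i => c i + s • P (c i))
        = (1 + s * δ j) ^ 2 * (∑ k, relLen (fun i => c i + s • P (c i)) k * A j k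
          - (∑ k, relLen (fun i => c i + s • P (c i)) k * B j k) ^ 2) := by
      intro s j
      have e0 : ∀ v, inner ℝ (f j) (v + s • P v) = (1 + s * δ j) * inner ℝ (f j) v := by
        intro v
        rw [inner_add_right, real_inner_smul_right, hP]; ring
      have e1 : ∀ x y : EuclideanSpace ℝ (Fin n), (1 / 2 : ℝ) • (x + s • P x + (y + s • P y))
          = (1 / 2 : ℝ) • (x + y) + s • P ((1 / 2 : ℝ) • (x + y)) := by
        intro x y
        rw [map_smul, map_add]; module
      rw [polyVar_eq]
      simp only [hA, hB, simpson]
      simp_rw [e1, e0]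
      rw [mul_sub, ← mul_pow, Finset.mul_sum, Finset.mul_sum]
      congr 1
      · exact Finset.sum_congr rfl fun k _ => by ring
      · congr 1
        exact Finset.sum_congr rfl fun k _ => by ring
    have hd : ∀ j, HasDerivAt (fun s : ℝ => polyVar (f j) (fun i => c i + s • P (c i)))
        (2 * δ j * ∑ k, relLen c k * A j k
        + ∑ k, relLen c k * (a k - ∑ i, relLen c i * a i) * A j k) 0 := by
      intro j
      simp_rw [hval]
      have d1 : HasDerivAt (fun s : ℝ => (1 + s * δ j) ^ 2) (2 * δ j) 0 := by
        have := (((hasDerivAt_id (0 : ℝ)).mul_const (δ j)).const_add 1).fun_pow 2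
        simpa using this
      have d2 := HasDerivAt.fun_sum (u := Finset.univ) fun k _ => (hw k).mul_const (A j k)
      have d3 := (HasDerivAt.fun_sum (u := Finset.univ) fun k _ => (hw k).mul_const (B j k)).pow 2
      refine (d1.mul (d2.sub d3)).congr_deriv ?_
      simp [hB0]
    have := (HasDerivAt.fun_sum (u := Finset.univ) fun j _ => (hd j).const_mul (l j)).unique (hst P)
    exact this
  -- scaling
  have htr : ∑ k, relLen c k * ∑ j, l j * A j k = 0 := by
    have h1 := hder (fun _ => 1) (ContinuousLinearMap.id ℝ _) (fun _ => 1) (by simp)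
      (by simp)
    have hw1 : ∑ i, relLen c i = 1 := by
      have hZ : (∑ i : Fin M, ‖c i.succ - c i.castSucc‖) ≠ 0 :=
        (Finset.sum_pos (fun i _ => norm_pos_iff.2 (hc i)) ⟨⟨0, hM⟩, Finset.mem_univ _⟩).ne'
      simp only [relLen]
      rw [← Finset.sum_div, div_self hZ]
    simp only [mul_one, hw1, sub_self, mul_zero, zero_mul, Finset.sum_const_zero, add_zero] at h1
    simp_rw [Finset.mul_sum] at h1 ⊢
    rw [Finset.sum_comm]
    have h2 : ∑ j, ∑ k, l j * (2 * (relLen c k * A j k))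
        = 2 * ∑ j, ∑ k, relLen c k * (l j * A j k) := by
      simp_rw [Finset.mul_sum]
      exact Finset.sum_congr rfl fun j _ => Finset.sum_congr rfl fun k _ => by ring
    linarith
  -- the projection to the span of the positive directions
  set δ : Fin n → ℝ := fun j => if 0 < l j then 1 else 0 with hδ
  set P : EuclideanSpace ℝ (Fin n) →L[ℝ] EuclideanSpace ℝ (Fin n) :=
    ∑ j, (innerSL ℝ (f j)).smulRight (δ j • f j) with hPdef
  have hP : ∀ j v, inner ℝ (f j) (P v) = δ j * inner ℝ (f j) v := by
    intro j v
    simp only [hPdef, sum_apply, ContinuousLinearMap.smulRight_apply,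
      innerSL_apply_apply, inner_sum, real_inner_smul_right,
      orthonormal_iff_ite.1 f.orthonormal]
    simp [mul_comm]
  have hin : ∀ v, inner ℝ v (P v) = ∑ j, δ j * inner ℝ (f j) v ^ 2 := by
    intro v
    rw [← f.sum_inner_mul_inner]
    refine Finset.sum_congr rfl fun j _ => ?_
    rw [hP, real_inner_comm]; ring
  have hnorm : ∀ v : EuclideanSpace ℝ (Fin n), ‖v‖ ^ 2 = ∑ j, inner ℝ (f j) v ^ 2 := by
    intro v
    rw [← real_inner_self_eq_norm_sq, ← f.sum_inner_mul_inner]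
    refine Finset.sum_congr rfl fun j _ => ?_
    rw [real_inner_comm]; ring
  set a : Fin M → ℝ := fun k => inner ℝ (c k.succ - c k.castSucc) (P (c k.succ - c k.castSucc))
    / ‖c k.succ - c k.castSucc‖ ^ 2 with ha
  have hδ01 : ∀ j, 0 ≤ δ j ∧ δ j ≤ 1 := by
    intro j
    simp only [hδ]
    split_ifs <;> norm_num
  have ha0 : ∀ k, 0 ≤ a k := fun k => div_nonneg (by
    rw [hin]
    exact Finset.sum_nonneg fun j _ => mul_nonneg (hδ01 j).1 (sq_nonneg _)) (sq_nonneg _)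
  have ha1 : ∀ k, a k ≤ 1 := fun k => div_le_one_of_le₀ (by
    rw [hin, hnorm]
    exact Finset.sum_le_sum fun j _ => mul_le_of_le_one_left (sq_nonneg _) (hδ01 j).2) (sq_nonneg _)
  have h2 := hder δ P a hP fun k => by
    have := norm_ne_zero_iff.2 (hc k)
    simp only [ha]
    field_simp
  set qp : Fin M → ℝ := fun k => ∑ j, δ j * l j * A j k with hqp
  set qm : Fin M → ℝ := fun k => ∑ j, (1 - δ j) * (-l j) * A j k with hqm
  have hq : ∀ k, ∑ j, l j * A j k = qp k - qm k := by
    intro k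
    simp only [hqp, hqm]
    rw [← Finset.sum_sub_distrib]
    exact Finset.sum_congr rfl fun j _ => by ring
  have hqp0 : ∀ k, 0 ≤ qp k := fun k => Finset.sum_nonneg fun j _ => by
    refine mul_nonneg ?_ (hA0 j k)
    simp only [hδ]
    split_ifs with h
    · linarith
    · simp
  have hqm0 : ∀ k, 0 ≤ qm k := fun k => Finset.sum_nonneg fun j _ => by
    refine mul_nonneg ?_ (hA0 j k)
    simp only [hδ]
    split_ifs with h
    · simp
    · linarith
  have h3 : 2 * ∑ k, relLen c k * qp k + ∑ k, relLen c k * a k * (qp k - qm k) = 0 := by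
    rw [← h2]
    have e1 : ∑ k, relLen c k * a k * (qp k - qm k)
        = ∑ k, relLen c k * (a k - ∑ i, relLen c i * a i) * ∑ j, l j * A j k := by
      have : ∑ k, relLen c k * (a k - ∑ i, relLen c i * a i) * ∑ j, l j * A j k
          = ∑ k, relLen c k * a k * ∑ j, l j * A j k
            - (∑ i, relLen c i * a i) * ∑ k, relLen c k * ∑ j, l j * A j k := by
        rw [Finset.mul_sum, ← Finset.sum_sub_distrib]
        exact Finset.sum_congr rfl fun k _ => by ring
      rw [this, htr, mul_zero, sub_zero]
      simp_rw [hq]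
    have e2 : ∀ g : Fin M → ℝ, ∑ j, l j * ∑ k, g k * A j k = ∑ k, g k * ∑ j, l j * A j k := by
      intro g
      simp_rw [Finset.mul_sum]
      rw [Finset.sum_comm]
      exact Finset.sum_congr rfl fun k _ => Finset.sum_congr rfl fun j _ => by ring
    simp_rw [mul_add]
    rw [Finset.sum_add_distrib, e2, ← e1]
    congr 1
    simp only [hqp]
    simp_rw [Finset.mul_sum]
    rw [Finset.sum_comm]
    exact Finset.sum_congr rfl fun k _ => Finset.sum_congr rfl fun j _ => by ring
  simp_rw [hq, mul_sub] at htr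
  rw [Finset.sum_sub_distrib] at htr
  have h4 : ∑ k, relLen c k * a k * (qm k - qp k) ≤ ∑ k, relLen c k * qm k := by
    refine Finset.sum_le_sum fun k _ => ?_
    rw [mul_assoc]
    refine mul_le_mul_of_nonneg_left ?_ (relLen_nonneg c k)
    nlinarith [ha0 k, ha1 k, hqp0 k, hqm0 k, mul_nonneg (ha0 k) (hqp0 k)]
  have h5 : ∑ k, relLen c k * a k * (qm k - qp k) = -∑ k, relLen c k * a k * (qp k - qm k) := by
    rw [← Finset.sum_neg_distrib]
    exact Finset.sum_congr rfl fun k _ => by ring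
  have h6 : ∑ k, relLen c k * qp k ≤ 0 := by linarith
  have h7 : ∀ k, qp k = 0 := by
    intro k
    have hnn : ∀ k ∈ Finset.univ, 0 ≤ relLen c k * qp k := fun k _ =>
      mul_nonneg (relLen_nonneg c k) (hqp0 k)
    have := (Finset.sum_eq_zero_iff_of_nonneg hnn).1
      (le_antisymm h6 (Finset.sum_nonneg hnn)) k (Finset.mem_univ k)
    exact (mul_eq_zero.1 this).resolve_left (relLen_pos hc k).ne'
  by_contra! hj
  refine f.orthonormal.ne_zero j (hspan (f j) fun k => ?_)
  have h8 : A j k = 0 := by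
    have hnn : ∀ j ∈ Finset.univ, 0 ≤ δ j * l j * A j k := fun j _ => by
      refine mul_nonneg ?_ (hA0 j k)
      simp only [hδ]
      split_ifs with h
      · linarith
      · simp
    have := (Finset.sum_eq_zero_iff_of_nonneg hnn).1 (h7 k) j (Finset.mem_univ j)
    have hdj : δ j = 1 := if_pos hj
    rw [hdj, one_mul] at this
    exact (mul_eq_zero.1 this).resolve_left hj.ne'
  simp only [hA, simpson] at h8
  have s1 := sq_nonneg (inner ℝ (f j) (c k.castSucc))
  have s2 := sq_nonneg (inner ℝ (f j) (c k.succ))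
  have s3 := sq_nonneg (inner ℝ (f j) ((1 / 2 : ℝ) • (c k.castSucc + c k.succ)))
  have h9 : inner ℝ (f j) (c k.castSucc) ^ 2 = 0 := by linarith
  have h10 : inner ℝ (f j) (c k.succ) ^ 2 = 0 := by linarith
  rw [inner_sub_right, (pow_eq_zero_iff two_ne_zero).1 h9, (pow_eq_zero_iff two_ne_zero).1 h10,
    sub_zero]

end Polygon

section Deformation

open Filter Topology

variable {M n : ℕ}

/-- A submersion is constant along a curve with any prescribed velocity in the kernel of its
derivative. -/
lemma exists_curve_of_mem_ker {E F : Type*} [NormedAddCommGroup E] [NormedSpace ℝ E]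
    [CompleteSpace E] [NormedAddCommGroup F] [NormedSpace ℝ F] [FiniteDimensional ℝ F] {f : E → F}
    {f' : E →L[ℝ] F} {a : E} (hf : HasStrictFDerivAt f f' a) (hf' : f'.range = ⊤) {v : E}
    (hv : f' v = 0) :
    ∃ z : ℝ → E, z 0 = a ∧ HasDerivAt z v 0 ∧ ∀ᶠ s in 𝓝 0, f (z s) = f a ∧ ContinuousAt z s := by
  set u : f'.ker := ⟨v, hv⟩ with hu
  set g := hf.implicitFunction _ _ hf' (f a) with hg
  have hgd := hf.to_implicitFunction hf'
  have hsc : Tendsto (fun s : ℝ => s • u) (𝓝 0) (𝓝 0) := by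
    have : Continuous fun s : ℝ => s • u := by fun_prop
    simpa using this.tendsto 0
  refine ⟨fun s => g (s • u), ?_, ?_, ?_⟩
  · change g ((0 : ℝ) • u) = a
    rw [zero_smul]
    exact hf.implicitFunction_apply_image hf'
  · have h1 : HasDerivAt (fun s : ℝ => s • u) u 0 := by
      simpa using (hasDerivAt_id (0 : ℝ)).smul_const u
    have h2 : HasFDerivAt g f'.ker.subtypeL ((0 : ℝ) • u) := by
      rw [zero_smul]; exact hgd.hasFDerivAt
    exact h2.comp_hasDerivAt (0 : ℝ) h1
  · have hmap := hf.map_implicitFunction_eq hf'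
    obtain ⟨K, t, ht, hK⟩ := hgd.exists_lipschitzOnWith
    filter_upwards [(tendsto_const_nhds.prodMk_nhds hsc).eventually hmap,
      hsc.eventually (eventually_mem_nhds_iff.2 ht)] with s h1 h2
    exact ⟨h1, (hK.continuousOn.continuousAt h2).comp (f := fun s : ℝ => s • u) (by fun_prop)⟩

lemma linearMap_apply_eq_sum (φ : (Fin n → Fin n → ℝ) →ₗ[ℝ] ℝ) (S : Fin n → Fin n → ℝ) :
    φ S = ∑ i, ∑ j, φ (Pi.single i (Pi.single j 1)) * S i j := by
  have hS : S = ∑ i, ∑ j, S i j • (Pi.single i (Pi.single j 1) : Fin n → Fin n → ℝ) := by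
    funext a b
    simp only [Finset.sum_apply, Pi.smul_apply, smul_eq_mul]
    rw [Finset.sum_eq_single a (fun i _ hi => Finset.sum_eq_zero fun j _ => by
      rw [Pi.single_eq_of_ne hi.symm]; simp) (by simp)]
    rw [Finset.sum_eq_single b (fun j _ hj => by simp [Pi.single_eq_of_ne hj.symm]) (by simp)]
    simp
  conv_lhs => rw [hS]
  simp only [map_sum, map_smul, smul_eq_mul]
  exact Finset.sum_congr rfl fun i _ => Finset.sum_congr rfl fun j _ => mul_comm _ _

lemma sum_mul_mul_eq_sum_eigenvalues {H : Matrix (Fin n) (Fin n) ℝ} (hH : H.IsHermitian)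
    (p : EuclideanSpace ℝ (Fin n)) :
    ∑ i, ∑ j, H i j * (p i * p j)
      = ∑ m, hH.eigenvalues m * inner ℝ (hH.eigenvectorBasis m) p ^ 2 := by
  set f := hH.eigenvectorBasis with hf
  have hT := Matrix.isSymmetric_toEuclideanLin_iff.2 hH
  have hTf : ∀ m, Matrix.toEuclideanLin H (f m) = hH.eigenvalues m • f m := by
    intro m
    have := hH.mulVec_eigenvectorBasis m
    ext i
    exact congrFun this i
  have h1 : ∑ i, ∑ j, H i j * (p i * p j) = inner ℝ p (Matrix.toEuclideanLin H p) := by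
    simp only [PiLp.inner_apply, Matrix.toLpLin_apply, Matrix.mulVec, dotProduct]
    refine Finset.sum_congr rfl fun i _ => ?_
    simp only [RCLike.inner_apply, conj_trivial, Finset.sum_mul]
    exact Finset.sum_congr rfl fun j _ => by ring
  rw [h1, ← f.sum_inner_mul_inner]
  refine Finset.sum_congr rfl fun m _ => ?_
  rw [← hT, hTf, real_inner_smul_left, real_inner_comm]
  ring

lemma sum_mul_polyCov_eq {ι : Type*} [Fintype ι] {H : Fin n → Fin n → ℝ} {l : ι → ℝ}
    {f : ι → EuclideanSpace ℝ (Fin n)}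
    (h : ∀ p : EuclideanSpace ℝ (Fin n),
      ∑ i, ∑ j, H i j * (p i * p j) = ∑ m, l m * inner ℝ (f m) p ^ 2)
    (c : Fin (M + 1) → EuclideanSpace ℝ (Fin n)) :
    ∑ i, ∑ j, H i j * polyCov c i j = ∑ m, l m * polyVar (f m) c := by
  have h1 : ∀ a b : EuclideanSpace ℝ (Fin n),
      ∑ i, ∑ j, H i j * simpson (fun p => p i * p j) a b
        = ∑ m, l m * simpson (fun p => inner ℝ (f m) p ^ 2) a b := by
    intro a b
    have ha := h a
    have hb := h b
    have hm := h ((1 / 2 : ℝ) • (a + b))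
    simp only [simpson]
    have e1 : ∀ i j, H i j * ((a i * a j + 4 * (((1 / 2 : ℝ) • (a + b)) i *
        ((1 / 2 : ℝ) • (a + b)) j) + b i * b j) / 6) = (1 / 6) * (H i j * (a i * a j))
        + (4 / 6) * (H i j * (((1 / 2 : ℝ) • (a + b)) i * ((1 / 2 : ℝ) • (a + b)) j))
        + (1 / 6) * (H i j * (b i * b j)) := fun i j => by ring
    have e2 : ∀ m, l m * ((inner ℝ (f m) a ^ 2 + 4 * inner ℝ (f m) ((1 / 2 : ℝ) • (a + b)) ^ 2
        + inner ℝ (f m) b ^ 2) / 6) = (1 / 6) * (l m * inner ℝ (f m) a ^ 2)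
        + (4 / 6) * (l m * inner ℝ (f m) ((1 / 2 : ℝ) • (a + b)) ^ 2)
        + (1 / 6) * (l m * inner ℝ (f m) b ^ 2) := fun m => by ring
    simp_rw [e1, e2, Finset.sum_add_distrib, ← Finset.mul_sum]
    rw [ha, hb, hm]
  simp only [polyCov, polyVar, mul_sub, Finset.sum_sub_distrib, Finset.mul_sum]
  rw [h]
  congr 1
  have h2 : ∀ k : Fin M, ∑ i, ∑ j, H i j * (relLen c k *
      simpson (fun p => p i * p j) (c k.castSucc) (c k.succ))
      = ∑ m, l m * (relLen c k *
        simpson (fun p => inner ℝ (f m) p ^ 2) (c k.castSucc) (c k.succ)) := by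
    intro k
    have := congrArg (relLen c k * ·) (h1 (c k.castSucc) (c k.succ))
    simp only [Finset.mul_sum] at this
    refine Eq.trans ?_ (this.trans ?_)
    · exact Finset.sum_congr rfl fun i _ => Finset.sum_congr rfl fun j _ => by ring
    · exact Finset.sum_congr rfl fun i _ => by ring
  exact ((Finset.sum_congr rfl fun i _ => Finset.sum_comm).trans Finset.sum_comm).trans
    ((Finset.sum_congr rfl fun k _ => h2 k).trans Finset.sum_comm)

/-- The covariance matrix of a deformed polygonal line, with an additional skew symmetric part. -/
noncomputable def deformedCov (c : Fin (M + 1) → EuclideanSpace ℝ (Fin n))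
    (z : (EuclideanSpace ℝ (Fin n) →L[ℝ] EuclideanSpace ℝ (Fin n)) × (Fin n → Fin n → ℝ))
    (i j : Fin n) : ℝ :=
  polyCov (fun m => z.1 (c m)) i j + (z.2 i j - z.2 j i)

lemma contDiffAt_deformedCov {c : Fin (M + 1) → EuclideanSpace ℝ (Fin n)} (hM : 0 < M)
    (hc : ∀ k : Fin M, c k.succ - c k.castSucc ≠ 0) :
    ContDiffAt ℝ 1 (deformedCov c) (ContinuousLinearMap.id ℝ _, 0) := by
  set z₀ : (EuclideanSpace ℝ (Fin n) →L[ℝ] EuclideanSpace ℝ (Fin n)) × (Fin n → Fin n → ℝ) :=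
    (ContinuousLinearMap.id ℝ _, 0) with hz₀
  have hv : ∀ v : EuclideanSpace ℝ (Fin n), ContDiffAt ℝ 1
      (fun z : (EuclideanSpace ℝ (Fin n) →L[ℝ] EuclideanSpace ℝ (Fin n)) × (Fin n → Fin n → ℝ) =>
        z.1 v) z₀ := fun v => contDiffAt_fst.clm_apply contDiffAt_const
  have hn : ∀ k : Fin M, ContDiffAt ℝ 1
      (fun z : (EuclideanSpace ℝ (Fin n) →L[ℝ] EuclideanSpace ℝ (Fin n)) × (Fin n → Fin n → ℝ) =>
        ‖z.1 (c k.succ) - z.1 (c k.castSucc)‖) z₀ := fun k =>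
    ((hv _).sub (hv _)).norm ℝ (by simpa [hz₀] using hc k)
  have hw : ∀ k : Fin M, ContDiffAt ℝ 1
      (fun z : (EuclideanSpace ℝ (Fin n) →L[ℝ] EuclideanSpace ℝ (Fin n)) × (Fin n → Fin n → ℝ) =>
        relLen (fun m => z.1 (c m)) k) z₀ := fun k => by
    unfold relLen
    refine (hn k).div (ContDiffAt.sum fun i _ => hn i) ?_
    exact (Finset.sum_pos (fun i _ => norm_pos_iff.2 (hc i)) ⟨⟨0, hM⟩, Finset.mem_univ _⟩).ne'
  have hco : ∀ (g : (EuclideanSpace ℝ (Fin n) →L[ℝ] EuclideanSpace ℝ (Fin n)) ×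
      (Fin n → Fin n → ℝ) → EuclideanSpace ℝ (Fin n)) (i : Fin n), ContDiffAt ℝ 1 g z₀ →
      ContDiffAt ℝ 1 (fun z => g z i) z₀ := fun g i hg => by fun_prop
  have hb : ContDiffAt ℝ 1
      (fun z : (EuclideanSpace ℝ (Fin n) →L[ℝ] EuclideanSpace ℝ (Fin n)) × (Fin n → Fin n → ℝ) =>
        barycenter (fun m => z.1 (c m))) z₀ := by
    unfold barycenter
    exact ContDiffAt.sum fun k _ => (hw k).smul (((hv _).add (hv _)).const_smul _)
  refine contDiffAt_pi.2 fun i => contDiffAt_pi.2 fun j => ?_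
  unfold deformedCov polyCov simpson
  refine ContDiffAt.add (ContDiffAt.sub (ContDiffAt.sum fun k _ => (hw k).mul ?_)
    ((hco _ i hb).mul (hco _ j hb))) (by fun_prop)
  have hm := ((hv (c k.castSucc)).add (hv (c k.succ))).const_smul (1 / 2 : ℝ)
  exact ((((hco _ i (hv _)).mul (hco _ j (hv _))).add
    (contDiffAt_const.mul ((hco _ i hm).mul (hco _ j hm)))).add
    ((hco _ i (hv _)).mul (hco _ j (hv _)))).div_const 6

lemma hasDerivAt_deformedCov_line {c : Fin (M + 1) → EuclideanSpace ℝ (Fin n)} (hM : 0 < M)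
    (hc : ∀ k : Fin M, c k.succ - c k.castSucc ≠ 0)
    (v : (EuclideanSpace ℝ (Fin n) →L[ℝ] EuclideanSpace ℝ (Fin n)) × (Fin n → Fin n → ℝ)) :
    HasDerivAt (fun s : ℝ => deformedCov c ((ContinuousLinearMap.id ℝ _, 0) + s • v))
      (fderiv ℝ (deformedCov c) (ContinuousLinearMap.id ℝ _, 0) v) 0 := by
  have hd := ((contDiffAt_deformedCov hM hc).differentiableAt one_ne_zero).hasFDerivAt
  set z₀ : (EuclideanSpace ℝ (Fin n) →L[ℝ] EuclideanSpace ℝ (Fin n)) × (Fin n → Fin n → ℝ) :=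
    (ContinuousLinearMap.id ℝ _, 0) with hz₀
  have h1 : HasDerivAt (fun s : ℝ => z₀ + s • v) v 0 := by
    simpa using ((hasDerivAt_id (0 : ℝ)).smul_const v).const_add z₀
  have h2 : HasFDerivAt (deformedCov c) (fderiv ℝ (deformedCov c) z₀) (z₀ + (0 : ℝ) • v) := by
    have hz : z₀ + (0 : ℝ) • v = z₀ := add_eq_left.2 (zero_smul ℝ v)
    rw [hz]
    exact hd
  exact h2.comp_hasDerivAt (0 : ℝ) h1

lemma range_fderiv_deformedCov {c : Fin (M + 1) → EuclideanSpace ℝ (Fin n)} (hM : 0 < M)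
    (hc : ∀ k : Fin M, c k.succ - c k.castSucc ≠ 0)
    (hspan : ∀ v, (∀ k : Fin M, inner ℝ v (c k.succ - c k.castSucc) = 0) → v = 0)
    (hbar : barycenter c = 0) :
    (fderiv ℝ (deformedCov c) (ContinuousLinearMap.id ℝ _, 0)).range = ⊤ := by
  by_contra hne
  obtain ⟨φ, hφ0, hφ⟩ := Submodule.exists_le_ker_of_lt_top _ (lt_top_iff_ne_top.2 hne)
  set z₀ : (EuclideanSpace ℝ (Fin n) →L[ℝ] EuclideanSpace ℝ (Fin n)) × (Fin n → Fin n → ℝ) :=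
    (ContinuousLinearMap.id ℝ _, 0) with hz₀
  have hline : ∀ v, HasDerivAt (fun s : ℝ => φ (deformedCov c (z₀ + s • v))) 0 0 := fun v =>
    ((LinearMap.toContinuousLinearMap φ).hasFDerivAt.comp_hasDerivAt (0 : ℝ)
      (hasDerivAt_deformedCov_line hM hc v)).congr_deriv (hφ ⟨v, rfl⟩)
  set H : Matrix (Fin n) (Fin n) ℝ := fun i j => φ (Pi.single i (Pi.single j 1)) with hHdef
  have hφH : ∀ S, φ S = ∑ i, ∑ j, H i j * S i j := linearMap_apply_eq_sum φ
  have hH : H.IsHermitian := by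
    ext i j
    simp only [Matrix.conjTranspose_apply, star_trivial]
    set K : Fin n → Fin n → ℝ := Pi.single i (Pi.single j 1) with hK
    have hKT : (fun a b => K b a) = (Pi.single j (Pi.single i 1) : Fin n → Fin n → ℝ) := by
      funext a b
      by_cases ha : a = j <;> by_cases hb : b = i <;> simp [hK, ha, hb, Pi.single_eq_of_ne]
    have h1 := hline (0, K)
    have h2 : ∀ s : ℝ, φ (deformedCov c (z₀ + s • (0, K)))
        = φ (deformedCov c z₀) + s * (H i j - H j i) := by
      intro s
      have : deformedCov c (z₀ + s • (0, K))
          = deformedCov c z₀ + s • (K - fun a b => K b a) := by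
        have hz : z₀ + s • ((0, K) : _ × (Fin n → Fin n → ℝ))
            = (ContinuousLinearMap.id ℝ (EuclideanSpace ℝ (Fin n)), s • K) := by
          simp [hz₀]
          exact smul_zero (A := EuclideanSpace ℝ (Fin n) →L[ℝ] EuclideanSpace ℝ (Fin n)) s
        rw [hz]
        funext a b
        simp only [deformedCov, hz₀, Pi.smul_apply, smul_eq_mul, Pi.zero_apply, Pi.add_apply,
          Pi.sub_apply]
        ring
      rw [this, map_add, map_smul, map_sub, hKT, smul_eq_mul]
    simp_rw [h2] at h1
    have h3 : HasDerivAt (fun s : ℝ => φ (deformedCov c z₀) + s * (H i j - H j i))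
        (H i j - H j i) 0 := by
      simpa using ((hasDerivAt_id (0 : ℝ)).mul_const (H i j - H j i)).const_add
        (φ (deformedCov c z₀))
    have := h3.unique h1
    linarith
  set f := hH.eigenvectorBasis with hf
  set l := hH.eigenvalues with hl
  have hst : ∀ Y : EuclideanSpace ℝ (Fin n) →L[ℝ] EuclideanSpace ℝ (Fin n),
      HasDerivAt (fun s : ℝ => ∑ j, l j * polyVar (f j) (fun i => c i + s • Y (c i))) 0 0 := by
    intro Y
    refine (hline (Y, 0)).congr_of_eventuallyEq (Filter.Eventually.of_forall fun s => ?_)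
    beta_reduce
    rw [hl, hf, ← sum_mul_polyCov_eq (sum_mul_mul_eq_sum_eigenvalues hH), hφH]
    refine Finset.sum_congr rfl fun i _ => Finset.sum_congr rfl fun j _ => ?_
    simp [deformedCov, hz₀]
  have hle := coeff_nonpos_of_stationary hM hc hspan hbar f l hst
  have hge := coeff_nonpos_of_stationary hM hc hspan hbar f (-l) fun Y => by
    have := (hst Y).neg
    simpa [Finset.sum_neg_distrib, Pi.neg_def] using this
  have hl0 : hH.eigenvalues = 0 := by
    funext j
    have h1 := hle j
    have h2 := hge j
    simp only [Pi.neg_apply] at h2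
    exact le_antisymm h1 (by simpa using h2)
  have hH0 := hH.eigenvalues_eq_zero_iff.1 hl0
  refine hφ0 (LinearMap.ext fun S => ?_)
  rw [hφH, hH0]
  simp

lemma exists_ker_fderiv_deformedCov {c : Fin (M + 1) → EuclideanSpace ℝ (Fin n)} (hM : 0 < M)
    (hn : 2 ≤ n) (hc : ∀ k : Fin M, c k.succ - c k.castSucc ≠ 0) :
    ∃ V : EuclideanSpace ℝ (Fin n) →L[ℝ] EuclideanSpace ℝ (Fin n), V ≠ 0 ∧
      fderiv ℝ (deformedCov c) (ContinuousLinearMap.id ℝ _, 0) (V, 0) = 0 := by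
  by_contra! hcon
  set z₀ : (EuclideanSpace ℝ (Fin n) →L[ℝ] EuclideanSpace ℝ (Fin n)) × (Fin n → Fin n → ℝ) :=
    (ContinuousLinearMap.id ℝ _, 0) with hz₀
  set D : (EuclideanSpace ℝ (Fin n) →L[ℝ] EuclideanSpace ℝ (Fin n)) →ₗ[ℝ] (Fin n → Fin n → ℝ) :=
    (fderiv ℝ (deformedCov c) z₀).toLinearMap ∘ₗ LinearMap.inl ℝ _ _ with hD
  have hinj : Function.Injective D := by
    rw [← LinearMap.ker_eq_bot, LinearMap.ker_eq_bot']
    intro V hV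
    by_contra h
    exact hcon V h hV
  have hfin : Module.finrank ℝ (EuclideanSpace ℝ (Fin n) →L[ℝ] EuclideanSpace ℝ (Fin n))
      = Module.finrank ℝ (Fin n → Fin n → ℝ) := by
    rw [← (LinearMap.toContinuousLinearMap (𝕜 := ℝ) (E := EuclideanSpace ℝ (Fin n))
      (F' := EuclideanSpace ℝ (Fin n))).finrank_eq, Module.finrank_linearMap]
    simp [Module.finrank_pi_fintype]
  obtain ⟨V, hV⟩ := (LinearMap.injective_iff_surjective_of_finrank_eq_finrank hfin).1 hinj
    (Pi.single ⟨0, by omega⟩ (Pi.single ⟨1, by omega⟩ 1))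
  have hsymm : ∀ i j, D V i j = D V j i := by
    intro i j
    have h3 := hasDerivAt_deformedCov_line hM hc (V, 0)
    have h4 : ∀ i j, HasDerivAt (fun s : ℝ =>
        deformedCov c (z₀ + s • ((V, 0) : _ × (Fin n → Fin n → ℝ))) i j) (D V i j) 0 := fun i j =>
      hasDerivAt_pi.1 (hasDerivAt_pi.1 h3 i) j
    refine (h4 i j).unique ((h4 j i).congr_of_eventuallyEq (Filter.Eventually.of_forall fun s => ?_))
    simp [deformedCov, hz₀, polyCov, mul_comm]
  have h := hsymm ⟨0, by omega⟩ ⟨1, by omega⟩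
  rw [hV] at h
  simp at h

/-- A centred polygonal line can be deformed linearly without changing its covariance matrix. -/
theorem exists_path_polyCov_eq {c : Fin (M + 1) → EuclideanSpace ℝ (Fin n)} (hM : 0 < M)
    (hn : 2 ≤ n) (hc : ∀ k : Fin M, c k.succ - c k.castSucc ≠ 0)
    (hspan : ∀ v, (∀ k : Fin M, inner ℝ v (c k.succ - c k.castSucc) = 0) → v = 0)
    (hbar : barycenter c = 0) :
    ∃ X : ℝ → EuclideanSpace ℝ (Fin n) →L[ℝ] EuclideanSpace ℝ (Fin n), Continuous X ∧
      X 0 = ContinuousLinearMap.id ℝ _ ∧ (∀ s, 0 < s → X s ≠ ContinuousLinearMap.id ℝ _) ∧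
      ∀ s, polyCov (fun m => X s (c m)) = polyCov c := by
  obtain ⟨V, hV0, hV⟩ := exists_ker_fderiv_deformedCov hM hn hc
  have hstr := (contDiffAt_deformedCov hM hc).hasStrictFDerivAt one_ne_zero
  have hrange := range_fderiv_deformedCov hM hc hspan hbar
  obtain ⟨z, hz0, hzd, hz⟩ := exists_curve_of_mem_ker hstr hrange hV
  have hne : ∀ᶠ s : ℝ in 𝓝[≠] 0, (z s).1 ≠ ContinuousLinearMap.id ℝ _ :=
    HasDerivAt.eventually_ne (hasFDerivAt_fst.comp_hasDerivAt (0 : ℝ) hzd) hV0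
  obtain ⟨ε, hε, hball⟩ := Metric.eventually_nhds_iff.1 (hz.and
    (eventually_nhdsWithin_iff.1 hne))
  set δ := ε / 2 with hδ
  have hδ0 : 0 < δ := by positivity
  have hin : ∀ s ∈ Set.Icc 0 δ, dist s 0 < ε := by
    intro s hs
    rw [Real.dist_eq, sub_zero, abs_of_nonneg hs.1]
    linarith [hs.2]
  refine ⟨Set.IccExtend hδ0.le (fun s : Set.Icc 0 δ => (z s).1), ?_, ?_, ?_, ?_⟩
  · refine Continuous.Icc_extend' ?_
    refine continuous_fst.comp (continuous_iff_continuousAt.2 fun s => ?_)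
    exact (hball (hin s s.2)).1.2.comp (f := ((↑) : Set.Icc 0 δ → ℝ)) (by fun_prop)
  · rw [Set.IccExtend_of_le_left _ _ le_rfl]
    simp [hz0]
  · intro s hs
    have hmem := (Set.projIcc 0 δ hδ0.le s).2
    refine (hball (hin _ hmem)).2 ?_
    rw [Set.mem_compl_iff, Set.mem_singleton_iff, Set.coe_projIcc]
    exact (lt_max_of_lt_right (lt_min hδ0 hs)).ne'
  · intro s
    have hmem := (Set.projIcc 0 δ hδ0.le s).2
    have h1 := (hball (hin _ hmem)).1.1
    funext i j
    have e1 := congrFun (congrFun h1 i) j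
    have e2 := congrFun (congrFun h1 j) i
    have hs : ∀ c' : Fin (M + 1) → EuclideanSpace ℝ (Fin n), polyCov c' j i = polyCov c' i j :=
      fun c' => by simp [polyCov, mul_comm]
    simp only [deformedCov, hs] at e1 e2
    change polyCov (fun m => (z (Set.projIcc 0 δ hδ0.le s : ℝ)).1 (c m)) i j
      = polyCov (fun m => c m) i j
    simp only [Pi.zero_apply, ContinuousLinearMap.id_apply] at e1 e2
    linarith

end Deformation

section PolygonMoments

variable {M n : ℕ}

lemma sum_relLen {E : Type*} [NormedAddCommGroup E] {c : Fin (M + 1) → E} (hM : 0 < M)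
    (hc : ∀ k : Fin M, c k.succ - c k.castSucc ≠ 0) : ∑ k, relLen c k = 1 := by
  simp only [relLen]
  rw [← Finset.sum_div]
  exact div_self (Finset.sum_pos (fun i _ => norm_pos_iff.2 (hc i))
    ⟨⟨0, hM⟩, Finset.mem_univ _⟩).ne'

lemma relLen_sub_const {E : Type*} [NormedAddCommGroup E] (c : Fin (M + 1) → E) (m : E) :
    relLen (fun i => c i - m) = relLen c := by
  funext k
  simp [relLen]

lemma relLen_isometry_comp {E F : Type*} [NormedAddCommGroup E] [NormedAddCommGroup F]
    [NormedSpace ℝ E] [NormedSpace ℝ F] (J : E →ₗᵢ[ℝ] F) (c : Fin (M + 1) → E) :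
    relLen (fun i => J (c i)) = relLen c := by
  funext k
  simp only [relLen, ← map_sub, J.norm_map]

lemma barycenter_isometry_comp {E F : Type*} [NormedAddCommGroup E] [NormedAddCommGroup F]
    [InnerProductSpace ℝ E] [InnerProductSpace ℝ F] (J : E →ₗᵢ[ℝ] F) (c : Fin (M + 1) → E) :
    barycenter (fun i => J (c i)) = J (barycenter c) := by
  simp only [barycenter, relLen_isometry_comp, map_sum, map_smul, map_add]

lemma barycenter_sub_const {E : Type*} [NormedAddCommGroup E] [InnerProductSpace ℝ E]
    {c : Fin (M + 1) → E} (hM : 0 < M) (hc : ∀ k : Fin M, c k.succ - c k.castSucc ≠ 0) (m : E) :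
    barycenter (fun i => c i - m) = barycenter c - m := by
  have h : ∀ k : Fin M, relLen c k • (1 / 2 : ℝ) • (c k.castSucc - m + (c k.succ - m))
      = relLen c k • (1 / 2 : ℝ) • (c k.castSucc + c k.succ) - relLen c k • m := by
    intro k
    rw [← smul_sub]
    congr 1
    module
  simp only [barycenter, relLen_sub_const, h, Finset.sum_sub_distrib, ← Finset.sum_smul,
    sum_relLen hM hc, one_smul]

/-- The covariance matrix is the second moment matrix of the centred polygonal line. -/
lemma sum_relLen_mul_simpson_sub_barycenter {c : Fin (M + 1) → EuclideanSpace ℝ (Fin n)}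
    (hM : 0 < M) (hc : ∀ k : Fin M, c k.succ - c k.castSucc ≠ 0) (i j : Fin n) :
    ∑ k, relLen c k * simpson (fun p => p i * p j) (c k.castSucc - barycenter c)
      (c k.succ - barycenter c) = polyCov c i j := by
  have hb : ∀ i, barycenter c i = ∑ k, relLen c k * ((1 / 2) * (c k.castSucc i + c k.succ i)) := by
    intro i
    simp [barycenter, mul_add]
  set m := barycenter c with hm
  have h : ∀ k : Fin M, relLen c k * simpson (fun p => p i * p j) (c k.castSucc - m) (c k.succ - m)
      = relLen c k * simpson (fun p => p i * p j) (c k.castSucc) (c k.succ)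
        - m i * (relLen c k * ((1 / 2) * (c k.castSucc j + c k.succ j)))
        - m j * (relLen c k * ((1 / 2) * (c k.castSucc i + c k.succ i)))
        + m i * m j * relLen c k := by
    intro k
    simp only [simpson, PiLp.sub_apply, PiLp.smul_apply, PiLp.add_apply, smul_eq_mul]
    ring
  simp_rw [h, Finset.sum_add_distrib, Finset.sum_sub_distrib, ← Finset.mul_sum]
  rw [← hb, ← hb, sum_relLen hM hc, polyCov, ← hm]
  ring

lemma sum_mul_simpson (H : Fin n → Fin n → ℝ) (a b : EuclideanSpace ℝ (Fin n)) :
    simpson (fun p => ∑ i, ∑ j, H i j * (p i * p j)) a b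
      = ∑ i, ∑ j, H i j * simpson (fun p => p i * p j) a b := by
  simp only [simpson, Finset.mul_sum, ← Finset.sum_add_distrib, Finset.sum_div]
  exact Finset.sum_congr rfl fun i _ => Finset.sum_congr rfl fun j _ => by ring

lemma integral_quadratic (a b c : ℝ) :
    ∫ u in (0 : ℝ)..1, (a + b * u + c * u ^ 2) = a + b / 2 + c / 3 := by
  have h : ∀ u ∈ Set.uIcc (0 : ℝ) 1,
      HasDerivAt (fun u => a * u + b / 2 * u ^ 2 + c / 3 * u ^ 3) (a + b * u + c * u ^ 2) u := by
    intro u _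
    refine HasDerivAt.congr_deriv ((((hasDerivAt_id u).const_mul a).fun_add
      ((hasDerivAt_pow 2 u).const_mul (b / 2))).fun_add
      ((hasDerivAt_pow 3 u).const_mul (c / 3))) ?_
    push_cast
    ring
  rw [intervalIntegral.integral_eq_sub_of_hasDerivAt h
    (Continuous.intervalIntegrable (by fun_prop) _ _)]
  ring

namespace PWLCurve

variable {d : ℕ} (C : PWLCurve M d)

lemma vertex_succ_sub_ne_zero (k : Fin M) : C.vertex k.succ - C.vertex k.castSucc ≠ 0 :=
  C.generic.ne_zero k

lemma knot_succ_sub_eq_relLen (k : Fin M) :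
    C.knot k.succ - C.knot k.castSucc = relLen C.vertex k := C.knot_succ_sub k

lemma knot_zero : C.knot 0 = 0 := by simp [knot]

lemma knot_last (hM : 0 < M) : C.knot (Fin.last M) = 1 := by
  have : (∑ k : Fin M, if (k : ℕ) < (Fin.last M : Fin (M + 1)) then ‖C.edge k‖ else 0)
      = C.length := by simp [length]
  rw [knot, this, div_self (C.length_pos ⟨0, hM⟩).ne']

lemma eval_knot_add (k : Fin M) {u : ℝ} (hu : u ∈ Set.Icc (0 : ℝ) 1) :
    C.eval (C.knot k.castSucc + relLen C.vertex k * u)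
      = C.vertex k.castSucc + u • (C.vertex k.succ - C.vertex k.castSucc) := by
  have h := C.knot_succ_sub_eq_relLen k
  have hp := relLen_pos C.vertex_succ_sub_ne_zero k
  have h1 : relLen C.vertex k * u ≤ relLen C.vertex k := mul_le_of_le_one_right hp.le hu.2
  have h2 : 0 ≤ relLen C.vertex k * u := mul_nonneg hp.le hu.1
  rw [C.eval_of_mem_Icc k ⟨by linarith, by linarith⟩, h,
    show C.knot k.succ = C.knot k.castSucc + relLen C.vertex k by linarith]
  have e1 : (C.knot k.castSucc + relLen C.vertex k * u - C.knot k.castSucc) / relLen C.vertex k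
      = u := by field_simp; ring
  have e2 : (C.knot k.castSucc + relLen C.vertex k * u - (C.knot k.castSucc + relLen C.vertex k))
      / relLen C.vertex k = u - 1 := by field_simp; ring
  rw [e1, e2]
  module

lemma integral_eval (hM : 0 < M) {g : EuclideanSpace ℝ (Fin d) → ℝ} (hg : Continuous g) :
    ∫ t in (0 : ℝ)..1, g (C.eval t) = ∑ k, relLen C.vertex k *
      ∫ u in (0 : ℝ)..1, g (C.vertex k.castSucc + u • (C.vertex k.succ - C.vertex k.castSucc)) := by
  have hgC : Continuous fun t => g (C.eval t) := hg.comp C.continuous_eval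
  set a : ℕ → ℝ := fun i => if h : i < M + 1 then C.knot ⟨i, h⟩ else 0 with ha
  have h0 : a 0 = 0 := by
    simp only [ha, Nat.zero_lt_succ, dif_pos]
    exact C.knot_zero
  have h1 : a M = 1 := by
    simp only [ha, Nat.lt_succ_self, dif_pos]
    exact C.knot_last hM
  have hsum := intervalIntegral.sum_integral_adjacent_intervals (a := a) (n := M) (μ := volume)
    (f := fun t => g (C.eval t)) fun k _ => hgC.intervalIntegrable _ _
  rw [h0, h1] at hsum
  rw [← hsum, Finset.sum_range]
  refine Finset.sum_congr rfl fun k _ => ?_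
  have e1 : a k = C.knot k.castSucc := by
    simp only [ha, k.2.trans (Nat.lt_succ_self M), dif_pos]
    rfl
  have e2 : a (k + 1) = C.knot k.succ := by
    simp only [ha, Nat.succ_lt_succ k.2, dif_pos]
    rfl
  have h := C.knot_succ_sub_eq_relLen k
  have hsub := intervalIntegral.smul_integral_comp_add_mul (a := 0) (b := 1)
    (fun t => g (C.eval t)) (relLen C.vertex k) (C.knot k.castSucc)
  rw [e1, e2, show C.knot k.succ = C.knot k.castSucc + relLen C.vertex k * 1 by linarith]
  rw [mul_zero, add_zero] at hsub
  rw [← hsub, smul_eq_mul]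
  congr 1
  refine intervalIntegral.integral_congr fun u hu => ?_
  rw [Set.uIcc_of_le zero_le_one] at hu
  simp only [C.eval_knot_add k hu]

lemma moment_one (hM : 0 < M) (j : Fin 1 → Fin d) : C.moment 1 j = barycenter C.vertex (j 0) := by
  have h := C.integral_eval hM (g := fun p => p (j 0)) (by fun_prop)
  simp only [moment, Fin.prod_univ_one]
  rw [h]
  simp only [barycenter, WithLp.ofLp_sum, Finset.sum_apply, PiLp.smul_apply, PiLp.add_apply,
    smul_eq_mul]
  refine Finset.sum_congr rfl fun k _ => ?_
  congr 1
  have := integral_quadratic (C.vertex k.castSucc (j 0))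
    (C.vertex k.succ (j 0) - C.vertex k.castSucc (j 0)) 0
  rw [show (1 / 2) * (C.vertex k.castSucc (j 0) + C.vertex k.succ (j 0)) =
    C.vertex k.castSucc (j 0) + (C.vertex k.succ (j 0) - C.vertex k.castSucc (j 0)) / 2 + 0 / 3 by
      ring, ← this]
  refine intervalIntegral.integral_congr fun u _ => ?_
  simp only [PiLp.sub_apply]
  ring

lemma moment_two (hM : 0 < M) (j : Fin 2 → Fin d) :
    C.moment 2 j = ∑ k, relLen C.vertex k *
      simpson (fun p => p (j 0) * p (j 1)) (C.vertex k.castSucc) (C.vertex k.succ) := by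
  have h := C.integral_eval hM (g := fun p => p (j 0) * p (j 1)) (by fun_prop)
  simp only [moment, Fin.prod_univ_two]
  rw [h]
  refine Finset.sum_congr rfl fun k _ => ?_
  congr 1
  set a := C.vertex k.castSucc
  set b := C.vertex k.succ
  have := integral_quadratic (a (j 0) * a (j 1))
    (a (j 0) * (b (j 1) - a (j 1)) + a (j 1) * (b (j 0) - a (j 0)))
    ((b (j 0) - a (j 0)) * (b (j 1) - a (j 1)))
  refine Eq.trans (intervalIntegral.integral_congr fun u _ => ?_) (this.trans ?_)
  · simp only [PiLp.add_apply, PiLp.smul_apply, PiLp.sub_apply, smul_eq_mul]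
    ring
  · simp only [simpson, PiLp.add_apply, PiLp.smul_apply, smul_eq_mul]
    ring

lemma moment_one_eq_zero_iff (hM : 0 < M) : C.moment 1 = 0 ↔ barycenter C.vertex = 0 := by
  constructor
  · intro h
    ext i
    rw [← C.moment_one hM fun _ => i, h]
    rfl
  · intro h
    funext j
    rw [C.moment_one hM, h]
    rfl

/-- Centred curves in a common subspace whose covariances agree have the same second moments. -/
lemma moment_two_eq_of_polyCov_eq {Γ : PWLCurve M d} (hM : 0 < M)
    (J : EuclideanSpace ℝ (Fin n) →ₗᵢ[ℝ] EuclideanSpace ℝ (Fin d))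
    {c q : Fin (M + 1) → EuclideanSpace ℝ (Fin n)} (hC : C.vertex = fun i => J (c i))
    (hΓ : Γ.vertex = fun i => J (q i - barycenter q)) (hc : barycenter c = 0)
    (hq : ∀ k : Fin M, q k.succ - q k.castSucc ≠ 0)
    (h : polyCov q = polyCov c) : C.moment 2 = Γ.moment 2 := by
  funext j
  set H : Fin n → Fin n → ℝ := fun i i' =>
    J (EuclideanSpace.single i 1) (j 0) * J (EuclideanSpace.single i' 1) (j 1) with hH
  have hJ : ∀ (p : EuclideanSpace ℝ (Fin n)) (a : Fin d),
      J p a = ∑ i, p i * J (EuclideanSpace.single i 1) a := by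
    intro p a
    have hp : p = ∑ i, p i • EuclideanSpace.single i (1 : ℝ) := by
      have := (EuclideanSpace.basisFun (Fin n) ℝ).sum_repr p
      simpa using this.symm
    conv_lhs => rw [hp]
    simp
  have hpp : ∀ p, J p (j 0) * J p (j 1) = ∑ i, ∑ i', H i i' * (p i * p i') := by
    intro p
    rw [hJ, hJ, Finset.sum_mul_sum]
    exact Finset.sum_congr rfl fun i _ => Finset.sum_congr rfl fun i' _ => by
      simp only [hH]; ring
  have hs : ∀ a b, simpson (fun p => p (j 0) * p (j 1)) (J a) (J b)
      = ∑ i, ∑ i', H i i' * simpson (fun p => p i * p i') a b := by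
    intro a b
    rw [← sum_mul_simpson]
    simp only [simpson, ← map_add, ← map_smul, hpp]
  have hS : ∀ r : Fin (M + 1) → EuclideanSpace ℝ (Fin n),
      ∑ k : Fin M, relLen r k * simpson (fun p => p (j 0) * p (j 1)) (J (r k.castSucc))
        (J (r k.succ)) = ∑ i, ∑ i', H i i' * ∑ k : Fin M, relLen r k *
        simpson (fun p => p i * p i') (r k.castSucc) (r k.succ) := by
    intro r
    simp_rw [hs, Finset.mul_sum]
    rw [Finset.sum_comm]
    refine Finset.sum_congr rfl fun i _ => ?_
    rw [Finset.sum_comm]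
    exact Finset.sum_congr rfl fun i' _ => Finset.sum_congr rfl fun k _ => by ring
  rw [C.moment_two hM, Γ.moment_two hM, hC, hΓ, relLen_isometry_comp J c,
    relLen_isometry_comp J fun i => q i - barycenter q, hS c, hS fun i => q i - barycenter q]
  refine Finset.sum_congr rfl fun i _ => Finset.sum_congr rfl fun i' _ => ?_
  congr 1
  rw [relLen_sub_const, sum_relLen_mul_simpson_sub_barycenter hM hq, h, polyCov, hc]
  simp

lemma moment_zero_eq (Γ : PWLCurve M d) : C.moment 0 = Γ.moment 0 := by
  funext j
  simp [moment]

end PWLCurve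

end PolygonMoments

namespace PWLCurve

open Filter Topology

variable {M d : ℕ}

section Rigidity

variable (C : PWLCurve M d)

lemma eval_knot (hM : 0 < M) (i : Fin (M + 1)) : C.eval (C.knot i) = C.vertex i := by
  have h0 : C.eval (C.knot (Fin.castSucc ⟨0, hM⟩)) = C.vertex (Fin.castSucc ⟨0, hM⟩) := by
    simpa using C.eval_knot_add ⟨0, hM⟩ (u := 0) ⟨le_rfl, zero_le_one⟩
  refine Fin.cases h0 (fun k => ?_) i
  have h := C.knot_succ_sub_eq_relLen k
  have := C.eval_knot_add k (u := 1) ⟨zero_le_one, le_rfl⟩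
  rw [mul_one, one_smul, show C.knot k.castSucc + relLen C.vertex k = C.knot k.succ by linarith]
    at this
  rw [this]
  abel

lemma eval_zero (hM : 0 < M) : C.eval 0 = C.vertex 0 := by
  rw [← C.knot_zero, C.eval_knot hM]

lemma eval_one (hM : 0 < M) : C.eval 1 = C.vertex (Fin.last M) := by
  rw [← C.knot_last hM, C.eval_knot hM]

lemma vertex_eq_add_sum_edge (i : Fin (M + 1)) :
    C.vertex i = C.vertex 0 + ∑ k : Fin M, if (k : ℕ) < i then C.edge k else 0 := by
  rw [C.sum_edge i i.2]
  simp

lemma sum_edge_univ : ∑ k, C.edge k = C.vertex (Fin.last M) - C.vertex 0 := by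
  have := C.vertex_eq_add_sum_edge (Fin.last M)
  rw [this]
  simp

lemma eval_zero_ne_eval_one (hM : 0 < M) : C.eval 0 ≠ C.eval 1 := by
  intro h
  rw [C.eval_zero hM, C.eval_one hM] at h
  have hsum : ∑ k : Fin M, (1 : ℝ) • (C.vertex k.succ - C.vertex k.castSucc) = 0 := by
    simp only [one_smul]
    exact C.sum_edge_univ.trans (by rw [h, sub_self])
  exact one_ne_zero (Fintype.linearIndependent_iff.1 C.generic (fun _ => 1) hsum ⟨0, hM⟩)

lemma knot_mem_Icc (hM : 0 < M) (i : Fin (M + 1)) : C.knot i ∈ Set.Icc (0 : ℝ) 1 := by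
  constructor
  · rw [← C.knot_zero]
    exact C.knot_mono (Fin.zero_le i)
  · rw [← C.knot_last hM]
    exact C.knot_mono (Fin.le_last i)

lemma eval_sub_eval (k : Fin M) {s t : ℝ} (hs : s ∈ Set.Icc (C.knot k.castSucc) (C.knot k.succ))
    (ht : t ∈ Set.Icc (C.knot k.castSucc) (C.knot k.succ)) :
    C.eval t - C.eval s = ((t - s) / relLen C.vertex k) • C.edge k := by
  rw [C.eval_of_mem_Icc k hs, C.eval_of_mem_Icc k ht, C.knot_succ_sub_eq_relLen, edge]
  simp only [sub_div]
  module

variable {C}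

lemma eq_of_edge_eq {Γ : PWLCurve M d} (h0 : Γ.vertex 0 = C.vertex 0) (h : Γ.edge = C.edge) :
    Γ = C := by
  have hv : Γ.vertex = C.vertex := by
    funext i
    rw [Γ.vertex_eq_add_sum_edge, C.vertex_eq_add_sum_edge, h0, h]
  cases C
  cases Γ
  subst hv
  rfl

/-- Two curves with interlacing knots are equal if their parametrizations are. -/
lemma eq_of_eqOn_eval {Γ : PWLCurve M d} (hM : 0 < M)
    (hk : ∀ k : Fin M, C.knot k.castSucc < Γ.knot k.succ)
    (hk' : ∀ k : Fin M, Γ.knot k.castSucc < C.knot k.succ)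
    (h : ∀ t ∈ Set.Icc (0 : ℝ) 1, C.eval t = Γ.eval t) : Γ = C := by
  have h0 : Γ.vertex 0 = C.vertex 0 := by
    rw [← C.eval_zero hM, ← Γ.eval_zero hM, h 0 ⟨le_rfl, zero_le_one⟩]
  have h1 : Γ.vertex (Fin.last M) = C.vertex (Fin.last M) := by
    rw [← C.eval_one hM, ← Γ.eval_one hM, h 1 ⟨zero_le_one, le_rfl⟩]
  have hedge : ∀ k, Γ.edge k = (relLen Γ.vertex k / relLen C.vertex k) • C.edge k := by
    intro k
    set a := max (C.knot k.castSucc) (Γ.knot k.castSucc) with ha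
    set b := min (C.knot k.succ) (Γ.knot k.succ) with hb
    have hab : a < b := max_lt (lt_min (C.knot_lt k) (hk k)) (lt_min (hk' k) (Γ.knot_lt k))
    have haC : a ∈ Set.Icc (C.knot k.castSucc) (C.knot k.succ) :=
      ⟨le_max_left _ _, hab.le.trans (min_le_left _ _)⟩
    have haΓ : a ∈ Set.Icc (Γ.knot k.castSucc) (Γ.knot k.succ) :=
      ⟨le_max_right _ _, hab.le.trans (min_le_right _ _)⟩
    have hbC : b ∈ Set.Icc (C.knot k.castSucc) (C.knot k.succ) :=
      ⟨haC.1.trans hab.le, min_le_left _ _⟩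
    have hbΓ : b ∈ Set.Icc (Γ.knot k.castSucc) (Γ.knot k.succ) :=
      ⟨haΓ.1.trans hab.le, min_le_right _ _⟩
    have hsub : Set.Icc (C.knot k.castSucc) (C.knot k.succ) ⊆ Set.Icc 0 1 :=
      Set.Icc_subset_Icc (C.knot_mem_Icc hM _).1 (C.knot_mem_Icc hM _).2
    have e := C.eval_sub_eval k haC hbC
    rw [h a (hsub haC), h b (hsub hbC), Γ.eval_sub_eval k haΓ hbΓ] at e
    have hΓ := relLen_pos Γ.vertex_succ_sub_ne_zero k
    have hC := relLen_pos C.vertex_succ_sub_ne_zero k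
    have hba : b - a ≠ 0 := (sub_pos.2 hab).ne'
    have e' := congrArg ((relLen Γ.vertex k / (b - a)) • ·) e
    simp only [smul_smul] at e'
    rw [show relLen Γ.vertex k / (b - a) * ((b - a) / relLen Γ.vertex k) = 1 by field_simp,
      one_smul] at e'
    rw [e']
    congr 1
    field_simp
  have hsum : ∑ k, (relLen Γ.vertex k / relLen C.vertex k - 1) •
      (C.vertex k.succ - C.vertex k.castSucc) = 0 := by
    change ∑ k, (relLen Γ.vertex k / relLen C.vertex k - 1) • C.edge k = 0
    simp only [sub_smul, one_smul, ← hedge, Finset.sum_sub_distrib, sum_edge_univ, h0, h1, sub_self]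
  have hone := Fintype.linearIndependent_iff.1 C.generic _ hsum
  refine eq_of_edge_eq h0 (funext fun k => ?_)
  rw [hedge, sub_eq_zero.1 (hone k), one_smul]

end Rigidity

section Continuity

variable {Y : Type*} [TopologicalSpace Y] {Γ : Y → PWLCurve M d}

lemma continuous_knot_family (hM : 0 < M) (hΓ : Continuous fun y => (Γ y).vertex)
    (i : Fin (M + 1)) : Continuous fun y => (Γ y).knot i := by
  have hv : ∀ i, Continuous fun y => (Γ y).vertex i := fun i => (continuous_apply i).comp hΓ
  have he : ∀ k : Fin M, Continuous fun y => ‖(Γ y).edge k‖ := fun k =>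
    ((hv k.succ).sub (hv k.castSucc)).norm
  unfold knot
  refine Continuous.div (continuous_finsetSum _ fun k _ => ?_)
    (continuous_finsetSum _ fun k _ => he k) fun y => ((Γ y).length_pos ⟨0, hM⟩).ne'
  split_ifs
  · exact he k
  · exact continuous_const

lemma continuous_eval_family (hM : 0 < M) (hΓ : Continuous fun y => (Γ y).vertex) :
    Continuous fun p : Y × ℝ => (Γ p.1).eval p.2 := by
  have hv : ∀ i, Continuous fun p : Y × ℝ => (Γ p.1).vertex i := fun i =>
    ((continuous_apply i).comp hΓ).comp continuous_fst
  have hk : ∀ i, Continuous fun p : Y × ℝ => (Γ p.1).knot i := fun i =>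
    (continuous_knot_family hM hΓ i).comp continuous_fst
  have he : ∀ k, Continuous fun p : Y × ℝ => (Γ p.1).edge k := fun k =>
    (hv k.succ).sub (hv k.castSucc)
  unfold eval
  refine (hv 0).add (continuous_finsetSum _ fun k _ => Continuous.fun_smul ?_ (he k))
  exact continuous_const.max (continuous_const.min (Continuous.div
    (continuous_snd.sub (hk _)) ((hk _).sub (hk _)) fun p => (sub_pos.2 ((Γ p.1).knot_lt k)).ne'))

lemma continuous_meanSqDist {f g : Y → ℝ → EuclideanSpace ℝ (Fin d)}
    (hf : Continuous (Function.uncurry f)) (hg : Continuous (Function.uncurry g)) :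
    Continuous fun y => meanSqDist (f y) (g y) := by
  unfold meanSqDist
  exact intervalIntegral.continuous_parametric_intervalIntegral_of_continuous'
    (f := fun y t => ‖f y t - g y t‖ ^ 2)
    (show Continuous fun p : Y × ℝ => ‖f.uncurry p - g.uncurry p‖ ^ 2 by fun_prop) 0 1

end Continuity

lemma meanSqDist_pos {f g : ℝ → EuclideanSpace ℝ (Fin d)} (hf : Continuous f) (hg : Continuous g)
    {t : ℝ} (ht : t ∈ Set.Icc (0 : ℝ) 1) (h : f t ≠ g t) : 0 < meanSqDist f g :=
  intervalIntegral.integral_pos zero_lt_one ((hf.sub hg).norm.pow 2).continuousOn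
    (fun _ _ => sq_nonneg _) ⟨t, ht, pow_pos (norm_pos_iff.2 (sub_ne_zero.2 h)) 2⟩

lemma rho_self (C : PWLCurve M d) : rho C C = 0 := by simp [rho, meanSqDist]

section Family

variable {C : PWLCurve M d}

/-- A centred curve lies in an isometric copy of a Euclidean space of dimension `M`. -/
lemma exists_linearIsometry (hM : 0 < M) (hC : barycenter C.vertex = 0) :
    ∃ (J : EuclideanSpace ℝ (Fin M) →ₗᵢ[ℝ] EuclideanSpace ℝ (Fin d))
      (c : Fin (M + 1) → EuclideanSpace ℝ (Fin M)), C.vertex = fun i => J (c i) := by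
  set S := Submodule.span ℝ (Set.range C.edge) with hS
  have hfin : Module.finrank ℝ S = M := by
    have := finrank_span_eq_card (R := ℝ) (b := C.edge) C.generic
    simpa using this
  set b := (stdOrthonormalBasis ℝ S).reindex (finCongr hfin) with hb
  set J := S.subtypeₗᵢ.comp b.repr.symm.toLinearIsometry with hJ
  have hmem : ∀ i, C.vertex i - C.vertex 0 ∈ S := by
    intro i
    rw [C.vertex_eq_add_sum_edge i, add_sub_cancel_left]
    refine Submodule.sum_mem _ fun k _ => ?_
    split_ifs
    · exact Submodule.subset_span ⟨k, rfl⟩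
    · exact S.zero_mem
  have h0 : C.vertex 0 ∈ S := by
    have h1 := barycenter_sub_const hM C.vertex_succ_sub_ne_zero (C.vertex 0)
    rw [hC, zero_sub] at h1
    rw [← neg_neg (C.vertex 0), ← h1]
    refine S.neg_mem (Submodule.sum_mem _ fun k _ => S.smul_mem _ (S.smul_mem _ ?_))
    exact S.add_mem (hmem _) (hmem _)
  have hv : ∀ i, C.vertex i ∈ S := fun i => by
    simpa using S.add_mem (hmem i) h0
  exact ⟨J, fun i => b.repr ⟨C.vertex i, hv i⟩, by funext i; simp [hJ]⟩

/-- A centred curve can be deformed without changing its first two moments. -/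
theorem exists_family_moment_eq (hM : 2 ≤ M) (hC : C.moment 1 = 0) :
    ∃ Γ : ℝ → PWLCurve M d, (Continuous fun s => (Γ s).vertex) ∧ Γ 0 = C ∧
      (∀ s, 0 < s → Γ s ≠ C) ∧ ∀ s, (Γ s).moment 1 = 0 ∧ C.moment 2 = (Γ s).moment 2 := by
  have hM0 : 0 < M := by omega
  rw [C.moment_one_eq_zero_iff hM0] at hC
  obtain ⟨J, c, hJc⟩ := exists_linearIsometry hM0 hC
  have hbar : barycenter c = 0 := by
    rw [hJc, barycenter_isometry_comp] at hC
    exact J.injective (hC.trans J.map_zero.symm)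
  have hli : LinearIndependent ℝ fun k : Fin M => c k.succ - c k.castSucc := by
    refine LinearIndependent.of_comp J.toLinearMap ?_
    have := C.generic
    rw [hJc] at this
    simpa [Function.comp_def] using this
  have htop := hli.span_eq_top_of_card_eq_finrank' (by simp)
  have hspan : ∀ v, (∀ k : Fin M, inner ℝ v (c k.succ - c k.castSucc) = 0) → v = 0 := by
    intro v hv
    have hv' : v ∈ Submodule.span ℝ (Set.range fun k : Fin M => c k.succ - c k.castSucc) := by
      rw [htop]; trivial
    refine (inner_self_eq_zero (𝕜 := ℝ)).1 (Submodule.span_induction (p := fun x _ => inner ℝ v x = 0)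
      ?_ (inner_zero_right _) ?_ ?_ hv')
    · rintro _ ⟨k, rfl⟩
      exact hv k
    · intro x y _ _ hx hy
      rw [inner_add_right, hx, hy, add_zero]
    · intro a x _ hx
      rw [inner_smul_right, hx, mul_zero]
  obtain ⟨X, hX, hX0, hXne, hXcov⟩ := exists_path_polyCov_eq hM0 hM (fun k => hli.ne_zero k)
    hspan hbar
  have hXli : ∀ᶠ s in 𝓝 0, LinearIndependent ℝ fun k : Fin M =>
      X s (c k.succ - c k.castSucc) := by
    have hcont : Continuous fun s => fun k : Fin M => X s (c k.succ - c k.castSucc) :=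
      continuous_pi fun k => hX.clm_apply continuous_const
    refine (hcont.tendsto 0).eventually (LinearIndependent.eventually ?_)
    simpa [hX0] using hli
  obtain ⟨ε, hε, hball⟩ := Metric.eventually_nhds_iff.1 hXli
  set φ : ℝ → ℝ := fun s => max 0 (min (ε / 2) s) with hφ
  have hφc : Continuous φ := by fun_prop
  have hφli : ∀ s, LinearIndependent ℝ fun k : Fin M => X (φ s) (c k.succ - c k.castSucc) := by
    intro s
    refine hball ?_
    rw [Real.dist_eq, sub_zero, abs_of_nonneg (le_max_left _ _)]
    exact (max_le (by positivity) (min_le_left _ _)).trans_lt (half_lt_self hε)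
  set q : ℝ → Fin (M + 1) → EuclideanSpace ℝ (Fin M) := fun s i => X (φ s) (c i) with hq
  have hqli : ∀ s, LinearIndependent ℝ fun k : Fin M => q s k.succ - q s k.castSucc := by
    intro s
    simpa only [hq, ← map_sub] using hφli s
  have hqc : ∀ i, Continuous fun s => q s i := fun i =>
    (hX.comp hφc).clm_apply continuous_const
  have hqne : ∀ s (k : Fin M), q s k.succ - q s k.castSucc ≠ 0 := fun s k => (hqli s).ne_zero k
  have hqn : ∀ k : Fin M, Continuous fun s => ‖q s k.succ - q s k.castSucc‖ := fun k =>
    ((hqc _).sub (hqc _)).norm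
  have hbc : Continuous fun s => barycenter (q s) := by
    unfold barycenter relLen
    refine continuous_finsetSum _ fun k _ => Continuous.fun_smul (Continuous.div (hqn k)
      (continuous_finsetSum _ fun k _ => hqn k) fun s => ?_)
      (Continuous.fun_const_smul (g := fun s => q s k.castSucc + q s k.succ)
        ((hqc _).add (hqc _)) _)
    exact (Finset.sum_pos (fun i _ => norm_pos_iff.2 (hqne s i))
      ⟨⟨0, hM0⟩, Finset.mem_univ _⟩).ne'
  let Γ : ℝ → PWLCurve M d := fun s =>
    { vertex := fun i => J (q s i - barycenter (q s))
      generic := by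
        have := (hqli s).map' J.toLinearMap (LinearMap.ker_eq_bot.2 J.injective)
        simp only [← map_sub, sub_sub_sub_cancel_right]
        exact this }
  have hedge : ∀ s k, (Γ s).edge k = J (X (φ s) (c k.succ - c k.castSucc)) := by
    intro s k
    simp only [edge, Γ, ← map_sub, sub_sub_sub_cancel_right, hq]
  have hCedge : ∀ k, C.edge k = J (c k.succ - c k.castSucc) := by
    intro k
    simp only [edge, hJc, map_sub]
  have hφ0 : φ 0 = 0 := by
    simp [hφ]
  refine ⟨Γ, continuous_pi fun i => J.continuous.comp ((hqc i).sub hbc), ?_, ?_, fun s => ⟨?_, ?_⟩⟩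
  · have hq0 : q 0 = c := by
      funext i
      simp [hq, hφ0, hX0]
    refine eq_of_edge_eq ?_ (funext fun k => ?_)
    · simp only [Γ, hq0, hbar, sub_zero, hJc]
    · rw [hedge, hCedge, hφ0, hX0, ContinuousLinearMap.id_apply]
  · intro s hs hΓ
    refine hXne (φ s) (lt_max_of_lt_right (lt_min (half_pos hε) hs))
      (ContinuousLinearMap.ext fun x => ?_)
    refine LinearMap.eqOn_span (R := ℝ) (f := (X (φ s)).toLinearMap) (g := LinearMap.id) ?_
      (show x ∈ Submodule.span ℝ (Set.range fun k : Fin M => c k.succ - c k.castSucc) by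
        rw [htop]; trivial)
    rintro _ ⟨k, rfl⟩
    refine J.injective ((hedge s k).symm.trans ?_)
    rw [hΓ, hCedge]
    rfl
  · rw [(Γ s).moment_one_eq_zero_iff hM0]
    change barycenter (fun i => J (q s i - barycenter (q s))) = 0
    rw [barycenter_isometry_comp J fun i => q s i - barycenter (q s),
      barycenter_sub_const hM0 (hqne s), sub_self, map_zero]
  · exact C.moment_two_eq_of_polyCov_eq hM0 J hJc rfl hbar (hqne s) (hXcov (φ s))

end Family

/-- All curves of a continuous family that are close to `C` satisfy the side conditions. -/
lemma eventually_admissible_aligned {C : PWLCurve M d} (hM : 0 < M) (hC : C.Admissible)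
    {Γ : ℝ → PWLCurve M d} (hΓ : Continuous fun s => (Γ s).vertex) (hΓ0 : Γ 0 = C)
    (hm : ∀ s, (Γ s).moment 1 = 0) :
    ∀ᶠ s in 𝓝 0, (Γ s).Admissible ∧
      (∀ t ∈ Set.Icc (0 : ℝ) 1, ‖C.eval t - (Γ s).eval t‖ ≤ 1 / 3) ∧ Aligned C (Γ s) ∧
      (Γ s ≠ C → 0 < rho C (Γ s)) := by
  have hev := continuous_eval_family hM hΓ
  have hCev : Continuous fun p : ℝ × ℝ => C.eval p.2 := C.continuous_eval.comp continuous_snd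
  have h1 : ∀ᶠ s in 𝓝 (0 : ℝ), ∀ t ∈ Set.Icc (0 : ℝ) 1, ‖(Γ s).eval t‖ < 1 := by
    refine isCompact_Icc.eventually_forall_of_forall_eventually fun t ht => ?_
    refine hev.norm.continuousAt.eventually_lt_const ?_
    simpa [hΓ0] using hC.2 t ht
  have h2 : ∀ᶠ s in 𝓝 (0 : ℝ), ∀ t ∈ Set.Icc (0 : ℝ) 1, ‖C.eval t - (Γ s).eval t‖ < 1 / 3 := by
    refine isCompact_Icc.eventually_forall_of_forall_eventually fun t ht => ?_
    refine (hCev.sub hev).norm.continuousAt.eventually_lt_const ?_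
    simp [hΓ0]
  have hρ : Continuous fun s => rho C (Γ s) :=
    continuous_meanSqDist (f := fun _ => C.eval) hCev hev
  have hrev : Continuous fun s => meanSqDist C.eval fun t => (Γ s).eval (1 - t) :=
    continuous_meanSqDist (f := fun _ => C.eval) (g := fun s t => (Γ s).eval (1 - t)) hCev
      (hev.comp (continuous_fst.prodMk (continuous_const.sub continuous_snd)))
  have h3 : ∀ᶠ s in 𝓝 (0 : ℝ), rho C (Γ s) < meanSqDist C.eval fun t => (Γ s).eval (1 - t) := by
    refine hρ.continuousAt.eventually_lt hrev.continuousAt ?_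
    rw [hΓ0, rho_self]
    refine meanSqDist_pos C.continuous_eval (C.continuous_eval.comp (by fun_prop))
      ⟨le_rfl, zero_le_one⟩ ?_
    simpa using C.eval_zero_ne_eval_one hM
  have hkn : ∀ i, Continuous fun s => (Γ s).knot i := continuous_knot_family hM hΓ
  have h4 : ∀ᶠ s in 𝓝 (0 : ℝ), ∀ k : Fin M, C.knot k.castSucc < (Γ s).knot k.succ :=
    eventually_all.2 fun k => (hkn _).continuousAt.eventually_const_lt (by
      simpa only [hΓ0] using C.knot_lt k)
  have h5 : ∀ᶠ s in 𝓝 (0 : ℝ), ∀ k : Fin M, (Γ s).knot k.castSucc < C.knot k.succ :=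
    eventually_all.2 fun k => (hkn _).continuousAt.eventually_lt_const (by
      simpa only [hΓ0] using C.knot_lt k)
  filter_upwards [h1, h2, h3, h4, h5] with s a1 a2 a3 a4 a5
  refine ⟨⟨hm s, a1⟩, fun t ht => (a2 t ht).le, a3.le, fun hne => ?_⟩
  by_contra hcon
  refine hne (eq_of_eqOn_eval hM a4 a5 fun t ht => ?_)
  by_contra ht'
  exact hcon (meanSqDist_pos C.continuous_eval (Γ s).continuous_eval ht ht')

/-- Curves at every sufficiently small distance from `C` share its first two moments. -/
theorem exists_rho_eq_moment_eq {C : PWLCurve M d} (hM : 2 ≤ M) (hC : C.Admissible) :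
    ∃ Δ₀ : ℝ, 0 < Δ₀ ∧ ∀ Δ : ℝ, 0 < Δ → Δ < Δ₀ → ∃ Γ : PWLCurve M d, Γ.Admissible ∧
      (∀ t ∈ Set.Icc (0 : ℝ) 1, ‖C.eval t - Γ.eval t‖ ≤ 1 / 3) ∧
      C.moment 2 = Γ.moment 2 ∧ Aligned C Γ ∧ rho C Γ = Δ := by
  have hM0 : 0 < M := by omega
  obtain ⟨Γ, hΓ, hΓ0, hne, hm⟩ := exists_family_moment_eq hM hC.1
  obtain ⟨ε, hε, hball⟩ := Metric.eventually_nhds_iff.1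
    (eventually_admissible_aligned hM0 hC hΓ hΓ0 fun s => (hm s).1)
  have hε2 : 0 < ε / 2 := half_pos hε
  have hin : ∀ s ∈ Set.Icc 0 (ε / 2), dist s 0 < ε := by
    intro s hs
    rw [Real.dist_eq, sub_zero, abs_of_nonneg hs.1]
    linarith [hs.2]
  refine ⟨rho C (Γ (ε / 2)), (hball (hin _ ⟨hε2.le, le_rfl⟩)).2.2.2 (hne _ hε2), fun Δ h0 h1 => ?_⟩
  have hρ : Continuous fun s => rho C (Γ s) :=
    continuous_meanSqDist (f := fun _ => C.eval) (C.continuous_eval.comp continuous_snd)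
      (continuous_eval_family hM0 hΓ)
  obtain ⟨s, hs, hsΔ⟩ := intermediate_value_Icc hε2.le hρ.continuousOn
    (show Δ ∈ Set.Icc (rho C (Γ 0)) (rho C (Γ (ε / 2))) by
      rw [hΓ0, rho_self]; exact ⟨h0.le, h1.le⟩)
  obtain ⟨p1, p2, p3, -⟩ := hball (hin s hs)
  exact ⟨Γ s, p1, p2, (hm s).2, p3, hsΔ⟩

end PWLCurve

theorem theorem3p5 :
    ∃ K : ℝ, 0 < K ∧
      ∀ (M d : ℕ), 2 ≤ M → M ≤ d →
      ∀ C : PWLCurve M d, C.Admissible →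
      ∃ Δ₀ : ℝ, 0 < Δ₀ ∧ ∀ Δ : ℝ, 0 < Δ → Δ < Δ₀ →
      ∃ Γ : PWLCurve M d,
        Γ ≠ C ∧
        Γ.Admissible ∧
        (∀ t ∈ Set.Icc (0 : ℝ) 1, ‖C.eval t - Γ.eval t‖ ≤ 1 / 3) ∧
        (∀ k ≤ 2, C.moment k = Γ.moment k) ∧
        PWLCurve.Aligned C Γ ∧
        PWLCurve.rho C Γ = Δ ∧
        ∀ (σ : ℝ) (N : ℕ), 1 ≤ σ → (N : ℝ) ≤ K * σ ^ 6 * Δ⁻¹ →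
          ∀ ψ : (Fin N → EuclideanSpace ℝ (Fin d)) → Bool, Measurable ψ →
            1 / 4 ≤ testError (C.sampleLaw σ N) (Γ.sampleLaw σ N) ψ := by
  refine ⟨1 / 30, by norm_num, fun M d hM _ C hC => ?_⟩
  obtain ⟨Δ₀, hΔ₀, h⟩ := PWLCurve.exists_rho_eq_moment_eq hM hC
  refine ⟨Δ₀, hΔ₀, fun Δ h0 h1 => ?_⟩
  obtain ⟨Γ, hΓ, hclose, hm, hal, hρ⟩ := h Δ h0 h1
  refine ⟨Γ, ?_, hΓ, hclose, ?_, hal, hρ, fun σ N hσ hN ψ hψ => ?_⟩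
  · rintro rfl
    rw [PWLCurve.rho_self] at hρ
    exact h0.ne hρ
  · intro k hk
    interval_cases k
    · exact C.moment_zero_eq Γ
    · rw [hC.1, hΓ.1]
    · exact hm
  · refine PWLCurve.quarter_le_testError_sampleLaw hC hΓ hm hσ ?_ hψ
    have hσ0 : 0 < σ := by linarith
    rw [hρ]
    calc (N : ℝ) * (σ⁻¹ ^ 6 * Δ) ≤ 1 / 30 * σ ^ 6 * Δ⁻¹ * (σ⁻¹ ^ 6 * Δ) := by gcongr
      _ = 1 / 30 := by field_simp
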